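/- A clause (a disjunction of literals) is horn if it has at most one positive literal, and co-horn if it has at most one negative literal. A Boolean relation $R\subseteq\{0,1\}^n$ is horn (resp. co-horn) if it is the set of satisfying assignments of a conjunction of horn (resp. co-horn) clauses in the variables $x_0,\dots,x_{n-1}$. For a class $S$ of Boolean relations, an $S$-formula over a set $V$ of variables is an expression $R(y_0,\dots,y_{n-1})$ with $R\in S$ of arity $n$ and $y_0,\dots,y_{n-1}\in V$ (not necessarily distinct). A set $C$ of formulas is finitely satisfiable if each finite subset of $C$ is satisfied by some truth assignment. A set $H\subseteq V$ is homogeneous for $C$ with color $c\in\{0,1\}$ if each finite subset of $C$ is satisfied by some truth assignment $\nu$ with $\nu(a)=c$ for all $a\in H$; it is homogeneous for $C$ if it is so with some color. $\mathsf{LRSAT}(S)$ is the statement: for every infinite set $V$ of variables, every finitely satisfiable set $C$ of $S$-formulas over $V$ and every infinite set $L\subseteq V$, there is an infinite set $H\subseteq L$ that is homogeneous for $C$. Let $\mathsf{RCA}_0$ be the system of second-order arithmetic with the basic axioms of arithmetic, $\Sigma^0_1$ induction and $\Delta^0_1$ comprehension, where finite sets, Boolean relations and formulas are coded by numbers in the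 usual way. Here $S$ is an arbitrary, possibly infinite, class of (codes of) Boolean relations, given by any formula of the language of second-order arithmetic (with parameters, and possibly with an additional unary predicate symbol about which there are no axioms and which does not occur in the induction and comprehension schemes). **Theorem.** $\mathsf{RCA}_0$ proves: if every relation in $S$ is horn, then $\mathsf{LRSAT}(S)$; and $\mathsf{RCA}_0$ proves: if every relation in $S$ is co-horn, then $\mathsf{LRSAT}(S)$. More precisely, put $c=1$ in the horn case and $c=0$ in the co-horn case, and for an instance $(V,C,L)$ let $F$ be the class of the $x\in L$ for which there is a finite $C_0\subseteq C$ such that $\nu(x)=c$ for all truth assignments $\nu$ that satisfy $C_0$. Then there is a $\Sigma^0_1$ formula $\theta(x)$ with parameters $V,C,L$, independent of $S$, such that $\mathsf{RCA}_0$ proves, if every relation in $S$ is horn (resp. co-horn): for each instance $(V,C,L)$ of $\mathsf{LRSAT}(S)$, the class $F$ is defined by $\theta$, and there is an infinite set $H\subseteq L$ such that either $F$ is infinite, $H\subseteq F$ and $H$ is homogeneous for $C$ with color $c$, or $F$ is finite, $H=L\setminus F$ and $H$ is homogeneous for $C$ with color $1-c$. -/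

import Mathlib

namespace SOA

/-! ## The language of second-order arithmetic

Two sorts of variables, for numbers and for sets of numbers, both in de Bruijn style: `var i` is
bound by the `i`-th enclosing number quantifier, or free if there is none; set variables are
counted separately, by the enclosing set quantifiers. -/

/-- Number terms. -/
inductive Tm : Type
  | var : ℕ → Tm
  | zero : Tm
  | one : Tm
  | add : Tm → Tm → Tm
  | mul : Tm → Tm → Tm

prefix:max "♯" => Tm.var

instance : Zero Tm := ⟨Tm.zero⟩
instance : One Tm := ⟨Tm.one⟩
instance : Add Tm := ⟨Tm.add⟩
instance : Mul Tm := ⟨Tm.mul⟩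

/-- Formulas.  Besides the symbols of second-order arithmetic there is a unary predicate symbol
`cls` on numbers, for an arbitrary class; it does not occur in the axioms of `RCA0`, nor in the
induction and comprehension formulas.  There is no equality between sets. -/
inductive Fm : Type
  | eq : Tm → Tm → Fm
  | lt : Tm → Tm → Fm
  /-- `mem t X`: the number `t` is an element of the set variable number `X` -/
  | mem : Tm → ℕ → Fm
  | cls : Tm → Fm
  | bot : Fm
  | imp : Fm → Fm → Fm
  /-- quantifier over numbers -/
  | all : Fm → Fm
  /-- quantifier over sets -/
  | allS : Fm → Fm

infixr:60 " ➔ " => Fm.imp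

/-- Simultaneous substitution in a term. -/
def Tm.subst (e : ℕ → Tm) : Tm → Tm
  | .var i => e i
  | .zero => .zero
  | .one => .one
  | .add t u => .add (t.subst e) (u.subst e)
  | .mul t u => .mul (t.subst e) (u.subst e)

/-- `t.up k` is `t` seen from under `k` more number quantifiers. -/
def Tm.up (t : Tm) (k : ℕ) : Tm := t.subst fun i => ♯(i + k)

/-- `t` for the variable `0`, and `e i` for the variable `i + 1`. -/
def scons {α : Type} (t : α) (e : ℕ → α) : ℕ → α
  | 0 => t
  | i + 1 => e i

/-- Capture-avoiding simultaneous substitution of the terms `e i` for the number variables and of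
the set variables `f i` for the set variables. -/
def Fm.subst : (ℕ → Tm) → (ℕ → ℕ) → Fm → Fm
  | e, _, .eq t u => .eq (t.subst e) (u.subst e)
  | e, _, .lt t u => .lt (t.subst e) (u.subst e)
  | e, f, .mem t X => .mem (t.subst e) (f X)
  | e, _, .cls t => .cls (t.subst e)
  | _, _, .bot => .bot
  | e, f, .imp φ ψ => .imp (φ.subst e f) (ψ.subst e f)
  | e, f, .all φ => .all (φ.subst (scons ♯0 fun i => (e i).up 1) f)
  | e, f, .allS φ => .allS (φ.subst e (scons 0 fun i => f i + 1))

/-- Weakening of `φ` under one more number quantifier. -/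
def Fm.wk (φ : Fm) : Fm := φ.subst (fun i => ♯(i + 1)) id

/-- Weakening of `φ` under one more set quantifier. -/
def Fm.wkS (φ : Fm) : Fm := φ.subst Tm.var (· + 1)

/-- `φ` with `t` for the number variable `0` (and the other number variables moved down). -/
def Fm.inst (φ : Fm) (t : Tm) : Fm := φ.subst (scons t Tm.var) id

/-- `φ` with `X` for the set variable `0` (and the other set variables moved down). -/
def Fm.instS (φ : Fm) (X : ℕ) : Fm := φ.subst Tm.var (scons X id)

/-- `φ` as a predicate of its number variable `0`, at `t`, where `t` lives under `k` additional
number quantifiers and `s` additional set quantifiers. -/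
def Fm.at (φ : Fm) (k s : ℕ) (t : Tm) : Fm := φ.subst (scons t fun i => ♯(i + k)) (· + s)

def Fm.neg (φ : Fm) : Fm := φ ➔ .bot
def Fm.and (φ ψ : Fm) : Fm := (φ ➔ ψ.neg).neg
def Fm.or (φ ψ : Fm) : Fm := φ.neg ➔ ψ
def Fm.iff (φ ψ : Fm) : Fm := (φ ➔ ψ).and (ψ ➔ φ)
def Fm.ex (φ : Fm) : Fm := φ.neg.all.neg
def Fm.exS (φ : Fm) : Fm := φ.neg.allS.neg

infixr:63 " ⋏ " => Fm.and
infixr:62 " ⋎ " => Fm.or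
infix:58 " ⟺ " => Fm.iff
infix:64 " ≐ " => Fm.eq
infix:64 " ≺ " => Fm.lt
infix:64 " ε " => Fm.mem

/-! ## Provability -/

/-- Classical natural deduction with equality.  `Derives T Γ φ`: the formula `φ` is derivable from
the axioms `T` and the assumptions `Γ`.  Free variables of an axiom are read as universally
quantified, so that each substitution instance of an axiom may be used; the free variables of an
assumption are fixed. -/
inductive Derives (T : Set Fm) : List Fm → Fm → Prop
  | ax {Γ : List Fm} {φ : Fm} (h : φ ∈ T) (e : ℕ → Tm) (f : ℕ → ℕ) : Derives T Γ (φ.subst e f)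
  | hyp {Γ : List Fm} {φ : Fm} (h : φ ∈ Γ) : Derives T Γ φ
  | impI {Γ : List Fm} {φ ψ : Fm} (h : Derives T (φ :: Γ) ψ) : Derives T Γ (φ ➔ ψ)
  | impE {Γ : List Fm} {φ ψ : Fm} (h : Derives T Γ (φ ➔ ψ)) (h' : Derives T Γ φ) : Derives T Γ ψ
  | contra {Γ : List Fm} {φ : Fm} (h : Derives T (φ.neg :: Γ) .bot) : Derives T Γ φ
  | allI {Γ : List Fm} {φ : Fm} (h : Derives T (Γ.map Fm.wk) φ) : Derives T Γ φ.all
  | allE {Γ : List Fm} {φ : Fm} (h : Derives T Γ φ.all) (t : Tm) : Derives T Γ (φ.inst t)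
  | allSI {Γ : List Fm} {φ : Fm} (h : Derives T (Γ.map Fm.wkS) φ) : Derives T Γ φ.allS
  | allSE {Γ : List Fm} {φ : Fm} (h : Derives T Γ φ.allS) (X : ℕ) : Derives T Γ (φ.instS X)
  | eqI {Γ : List Fm} (t : Tm) : Derives T Γ (t ≐ t)
  | eqE {Γ : List Fm} {t u : Tm} (φ : Fm) (h : Derives T Γ (t ≐ u)) (h' : Derives T Γ (φ.inst t)) :
      Derives T Γ (φ.inst u)

/-- `T ⊢ φ`. -/
def Proves (T : Set Fm) (φ : Fm) : Prop := Derives T [] φ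

/-! ## The axiom system `RCA0` -/

/-- Bounded-quantifier formulas (set variables are allowed as parameters). -/
inductive IsBounded : Fm → Prop
  | eq (t u : Tm) : IsBounded (t ≐ u)
  | lt (t u : Tm) : IsBounded (t ≺ u)
  | mem (t : Tm) (X : ℕ) : IsBounded (t ε X)
  | bot : IsBounded .bot
  | imp {φ ψ : Fm} (h : IsBounded φ) (h' : IsBounded ψ) : IsBounded (φ ➔ ψ)
  | ball (t : Tm) {φ : Fm} (h : IsBounded φ) : IsBounded (♯0 ≺ t.up 1 ➔ φ).all

def IsSigma01 (φ : Fm) : Prop := ∃ θ, IsBounded θ ∧ φ = θ.ex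

def IsPi01 (φ : Fm) : Prop := ∃ θ, IsBounded θ ∧ φ = θ.all

/-- Basic axioms, `Σ⁰₁` induction and `Δ⁰₁` comprehension. -/
inductive RCA0 : Set Fm
  | succ_ne_zero : RCA0 (♯0 + 1 ≐ 0).neg
  | succ_inj : RCA0 (♯0 + 1 ≐ ♯1 + 1 ➔ ♯0 ≐ ♯1)
  | add_zero : RCA0 (♯0 + 0 ≐ ♯0)
  | add_succ : RCA0 (♯0 + (♯1 + 1) ≐ (♯0 + ♯1) + 1)
  | mul_zero : RCA0 (♯0 * 0 ≐ 0)
  | mul_succ : RCA0 (♯0 * (♯1 + 1) ≐ ♯0 * ♯1 + ♯0)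
  | not_lt_zero : RCA0 (♯0 ≺ 0).neg
  | lt_succ : RCA0 (♯0 ≺ ♯1 + 1 ⟺ (♯0 ≺ ♯1 ⋎ ♯0 ≐ ♯1))
  | induction (φ : Fm) (h : IsSigma01 φ) :
      RCA0 (φ.inst 0 ➔ (φ ➔ φ.subst (scons (♯0 + 1) fun i => ♯(i + 1)) id).all ➔ φ.all)
  | comprehension (φ ψ : Fm) (h : IsSigma01 φ) (h' : IsPi01 ψ) :
      RCA0 ((φ ⟺ ψ).all ➔ (♯0 ε 0 ⟺ φ.wkS).all.exS)

/-! ## Coding of finite objects by numbers -/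

/-- The code `(t + u)² + t` of the ordered pair `(t, u)`. -/
def pair (t u : Tm) : Tm := (t + u) * (t + u) + t

/-- `t` is an element of the finite set coded by `c`: `c` is of the form `(k, (m, n))`, and `t < k`,
and `m (t + 1) + 1` divides `n`.  Each number codes a finite set, and in `RCA0` each bounded set
has a code. -/
def elt (t c : Tm) : Fm :=
  -- `∃ k m n, c = (k, (m, n)) ∧ t < k ∧ ∃ q, (m (t + 1) + 1) q = n`
  (c.up 3 ≐ pair ♯2 (pair ♯1 ♯0) ⋏ t.up 3 ≺ ♯2 ⋏
    ((♯2 * (t.up 4 + 1) + 1) * ♯0 ≐ ♯1).ex).ex.ex.ex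

/-! A Boolean vector in `{0,1}ⁿ` is coded by (a code of) the finite set of the `i < n` at which its
value is true.  A Boolean relation `R ⊆ {0,1}ⁿ` is coded by `(n, r)`, where `r` codes the finite set
of (codes of) the vectors in `R`. -/

/-- The vector `v` is in the relation `(n, r)`. -/
def vecMem (n r v : Tm) : Fm :=
  -- `∃ u, u ∈ r ∧ ∀ i, i < n → (i ∈ u ↔ i ∈ v)`
  (elt ♯0 (r.up 1) ⋏ (♯0 ≺ n.up 2 ➔ (elt ♯0 ♯1 ⟺ elt ♯0 (v.up 2))).all).ex

/-! A clause in the variables `x_i` (`i < n`) is coded by `(p, q)`, where `p` and `q` code the finite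
sets of the indices of its positive and of its negative literals; a conjunction of clauses is coded
by (a code of) the finite set of its clauses. -/

/-- The finite set `p` has at most one element. -/
def atMostOne (p : Tm) : Fm :=
  -- `∀ i j, i ∈ p → j ∈ p → i = j`
  (elt ♯1 (p.up 2) ➔ elt ♯0 (p.up 2) ➔ ♯1 ≐ ♯0).all.all

/-- All elements of the finite set `p` are less than `n`. -/
def below (p n : Tm) : Fm := (elt ♯0 (p.up 1) ➔ ♯0 ≺ n.up 1).all

/-- `h` is a conjunction of clauses in the variables `x_i`, `i < n`, each with at most one positive
literal (`c = true`), respectively at most one negative literal (`c = false`). -/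
def isHornFormula (c : Bool) (n h : Tm) : Fm :=
  -- `∀ d, d ∈ h → ∃ p q, d = (p, q) ∧ …`
  (elt ♯0 (h.up 1) ➔
    (♯2 ≐ pair ♯1 ♯0 ⋏ below ♯1 (n.up 3) ⋏ below ♯0 (n.up 3) ⋏
      atMostOne (if c then ♯1 else ♯0)).ex.ex).all

/-- The vector `v` satisfies the conjunction of clauses `h`. -/
def cnfTrue (h v : Tm) : Fm :=
  -- `∀ p q, (p, q) ∈ h → (∃ i, i ∈ p ∧ i ∈ v) ∨ (∃ i, i ∈ q ∧ i ∉ v)`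
  (elt (pair ♯1 ♯0) (h.up 2) ➔
    ((elt ♯0 ♯2 ⋏ elt ♯0 (v.up 3)).ex ⋎ (elt ♯0 ♯1 ⋏ (elt ♯0 (v.up 3)).neg).ex)).all.all

/-- `t` codes a Boolean relation that is defined by a horn (`c = true`), respectively co-horn
(`c = false`) formula. -/
def isHornRel (c : Bool) (t : Tm) : Fm :=
  -- `∃ n r h, t = (n, r) ∧ …`, and then `∀ v`
  (t.up 3 ≐ pair ♯2 ♯1 ⋏ isHornFormula c ♯2 ♯0 ⋏ (vecMem ♯3 ♯2 ♯0 ⟺ cnfTrue ♯1 ♯0).all).ex.ex.ex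

/-! For a relation `R` of arity `n`, the formula `R(y_0, …, y_{n-1})` is coded by `(R, y)`, where `y`
codes a finite set that contains, for each `i < n`, exactly one pair of the form `(i, z)`,
namely `(i, y_i)`.  Variables are the numbers in the set `V`. -/

/-- `t` is an `S`-formula over the set `V` of variables, where `S` is the class of (codes of)
relations defined by the formula `σ` in its number variable `0`.  The term `t` and the set variable
`V` live under `k` number quantifiers and `s` set quantifiers. -/
def isSFormula (σ : Fm) (k s : ℕ) (V : ℕ) (t : Tm) : Fm :=
  -- `∃ n r y, t = ((n, r), y) ∧ (n, r) ∈ S ∧ ∀ i, i < n → ∃ z, z ∈ V ∧ ∀ w, (i, w) ∈ y ↔ w = z`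
  (t.up 3 ≐ pair (pair ♯2 ♯1) ♯0 ⋏ σ.at (k + 3) s (pair ♯2 ♯1) ⋏
    (♯0 ≺ ♯3 ➔ (♯0 ε V ⋏ (elt (pair ♯2 ♯0) ♯3 ⟺ ♯0 ≐ ♯1).all).ex).all).ex.ex.ex

/-! A truth assignment is given by the set `X` of the variables to which it gives the value true. -/

/-- The assignment `X` satisfies the formula `t = R(y_0, …, y_{n-1})`. -/
def sat (X : ℕ) (t : Tm) : Fm :=
  -- `∃ n r y v, t = ((n, r), y) ∧ v ∈ (n, r) ∧ ∀ i, i < n → (i ∈ v ↔ ∃ z, (i, z) ∈ y ∧ z ∈ X)`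
  (t.up 4 ≐ pair (pair ♯3 ♯2) ♯1 ⋏ vecMem ♯3 ♯2 ♯0 ⋏
    (♯0 ≺ ♯4 ➔ (elt ♯0 ♯1 ⟺ (elt (pair ♯1 ♯0) ♯3 ⋏ ♯0 ε X).ex)).all).ex.ex.ex.ex

/-! ## The Ramsey-type satisfiability principle -/

def subset (X Y : ℕ) : Fm := (♯0 ε X ➔ ♯0 ε Y).all

/-- The class defined by `φ` in its number variable `0` is bounded. -/
def finClass (φ : Fm) : Fm :=
  -- `∃ b, ∀ x, φ(x) → x < b`
  (φ.at 2 0 ♯0 ➔ ♯0 ≺ ♯1).all.ex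

def finite (X : ℕ) : Fm := finClass (♯0 ε X)

def infinite (X : ℕ) : Fm := (finite X).neg

/-- The assignment `X` satisfies all formulas in the set `C`. -/
def satAll (X C : ℕ) : Fm := (♯0 ε C ➔ sat X ♯0).all

/-- Each finite subset of `C` is satisfiable. -/
def finSat (C : ℕ) : Fm :=
  -- `∀ F, F ⊆ C → F finite → ∃ X, X satisfies F`
  (subset 0 (C + 1) ➔ finite 0 ➔ (satAll 0 1).exS).allS

/-- The assignment `X` gives the value `c` to the variable `t`. -/
def hasValue (c : Bool) (X : ℕ) (t : Tm) : Fm := if c then t ε X else (t ε X).neg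

/-- `H` is homogeneous for `C` with color `c`. -/
def homogeneousWith (c : Bool) (H C : ℕ) : Fm :=
  -- `∀ F, F ⊆ C → F finite → ∃ X, X satisfies F ∧ ∀ a, a ∈ H → X(a) = c`
  (subset 0 (C + 1) ➔ finite 0 ➔
    (satAll 0 1 ⋏ (♯0 ε (H + 2) ➔ hasValue c 0 ♯0).all).exS).allS

def homogeneous (H C : ℕ) : Fm := homogeneousWith false H C ⋎ homogeneousWith true H C

/-- `(V, C, L)` (the set variables `2`, `1`, `0`) is an instance: `V` is infinite, `C` is a finitely
satisfiable set of `S`-formulas over `V`, and `L` is an infinite subset of `V`. -/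
def isInstance (σ : Fm) : Fm :=
  infinite 2 ⋏ (♯0 ε 1 ➔ isSFormula σ 1 3 2 ♯0).all ⋏ finSat 1 ⋏ infinite 0 ⋏ subset 0 2

/-- The principle `LRSAT(S)`, for the class `S` of relations defined by `σ` in its number
variable `0`. -/
def LRSAT (σ : Fm) : Fm :=
  -- `∀ V C L, (V, C, L) is an instance → ∃ H, …`
  (isInstance σ ➔ (infinite 0 ⋏ subset 0 1 ⋏ homogeneous 0 2).exS).allS.allS.allS

/-- Every relation in the class `S` defined by `σ` is horn (`c = true`), respectively co-horn
(`c = false`). -/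
def allHorn (c : Bool) (σ : Fm) : Fm := (σ ➔ isHornRel c ♯0).all

/-- The number variable `0` is in `L`, and some finite subset of `C` forces it to have the
value `c`. -/
def forced (c : Bool) (C L : ℕ) : Fm :=
  -- `x ∈ L ∧ ∃ F, F ⊆ C ∧ F finite ∧ ∀ X, X satisfies F → X(x) = c`
  ♯0 ε L ⋏ (subset 0 (C + 1) ⋏ finite 0 ⋏ (satAll 0 1 ➔ hasValue c 0 ♯0).allS).exS

/-- For each instance `(V, C, L)` of `LRSAT(S)`, the class of the `x ∈ L` that are forced to have
the value `c` is defined by `θ`, and there is an infinite set `H ⊆ L` for which one of the following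
holds: this class is infinite, it contains `H`, and `H` is homogeneous for `C` with color `c`; or
this class is finite, `H` is its complement in `L`, and `H` is homogeneous for `C` with the other
color.  (In `θ`, the number variable `0` is `x`, and the set variables `2`, `1`, `0` are `V`, `C`,
`L`.) -/
def LRSATForced (c : Bool) (θ σ : Fm) : Fm :=
  (isInstance σ ➔
    (θ ⟺ forced c 1 0).all ⋏
    (infinite 0 ⋏ subset 0 1 ⋏
      (((finClass (forced c 2 1)).neg ⋏ (♯0 ε 0 ➔ forced c 2 1).all ⋏ homogeneousWith c 0 2) ⋎
        (finClass (forced c 2 1) ⋏ (♯0 ε 0 ⟺ (♯0 ε 1 ⋏ (forced c 2 1).neg)).all ⋏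
          homogeneousWith (!c) 0 2))).exS).allS.allS.allS

end SOA

open SOA

namespace SOA

/-! ## Substitution -/

/-! By the completeness theorem, proved here with a Henkin term model, provability in `RCA0` reduces
to truth in every model, so the argument takes place inside an arbitrary, possibly nonstandard,
model. There `Σ⁰₁` induction yields arithmetic, `Σ⁰₁` collection and, by a version of Gödel's
β-function, a code for every bounded `Σ⁰₁` class (`exists_code`).

Let `F` be the class of forced variables. Its definition quantifies over finite subsets of `C` and
over all assignments. A formula mentions only variables smaller than its own code (`sat_congr`), so
only the values below a bound `k` matter. All subsets of `[0, k)` have codes below some `B`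
(`exists_complete`), and that `B` is adequate is a bounded property. Hence `F` is `Σ⁰₁`
(`forced_iff`), by a definition that does not mention `S`.

If `F` is unbounded, it contains an unbounded set `H` (`exists_unbounded_subset`). Collection bounds
the parts of `C` that force the elements of `H` below `b`, and any assignment satisfying enough of
`C` gives them all the value `c` (`homogeneousWith_of_forced`).

If `F` is bounded, it is a set, and so is `H = L \ F`. Each `x` in `H` gets the other value in some
assignment satisfying a given finite part of `C`. Satisfying assignments of horn formulas are closed
under intersection, those of co-horn formulas under union (`Sat.comb`), so these assignments combine
into one that gives the other value to all elements of `H` below `b`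
(`homogeneousWith_of_not_forced`). The combination is an induction on the number of variables
treated; restricting it to codes below `B` makes the induction formula bounded. Values from `b` on
are free and can be overridden (`homogeneousWith_of_forall`). -/

theorem Tm.subst_subst (t : Tm) (e e' : ℕ → Tm) :
    (t.subst e).subst e' = t.subst fun i => (e i).subst e' := by
  induction t <;> simp_all [Tm.subst]

theorem Tm.subst_var (t : Tm) : t.subst Tm.var = t := by
  induction t <;> simp_all [Tm.subst]

theorem Tm.up_inst (t u : Tm) : (t.up 1).subst (scons u Tm.var) = t := by
  rw [Tm.up, Tm.subst_subst]; exact t.subst_var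

/-- Substitution under a number quantifier. -/
def liftTm (e : ℕ → Tm) : ℕ → Tm := scons ♯0 fun i => (e i).up 1

/-- Renaming under a set quantifier. -/
def liftSet (f : ℕ → ℕ) : ℕ → ℕ := scons 0 fun i => f i + 1

theorem liftTm_comp (e e' : ℕ → Tm) :
    (fun i => (liftTm e i).subst (liftTm e')) = liftTm fun i => (e i).subst e' := by
  funext i
  cases i <;> simp [liftTm, scons, Tm.up, Tm.subst, Tm.subst_subst]

theorem liftSet_comp (f f' : ℕ → ℕ) : liftSet f' ∘ liftSet f = liftSet (f' ∘ f) := by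
  funext i
  cases i <;> simp [liftSet, scons]

theorem liftTm_var : liftTm Tm.var = Tm.var := by
  funext i
  cases i <;> rfl

theorem liftSet_id : liftSet id = id := by
  funext i
  cases i <;> rfl

theorem Fm.subst_all (φ : Fm) (e : ℕ → Tm) (f : ℕ → ℕ) :
    φ.all.subst e f = (φ.subst (liftTm e) f).all := rfl

theorem Fm.subst_allS (φ : Fm) (e : ℕ → Tm) (f : ℕ → ℕ) :
    φ.allS.subst e f = (φ.subst e (liftSet f)).allS := rfl

theorem Fm.subst_subst (φ : Fm) (e e' : ℕ → Tm) (f f' : ℕ → ℕ) :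
    (φ.subst e f).subst e' f' = φ.subst (fun i => (e i).subst e') (f' ∘ f) := by
  induction φ generalizing e e' f f' with
  | all φ ih => simp only [Fm.subst_all, ih, liftTm_comp]
  | allS φ ih => simp only [Fm.subst_allS, ih, liftSet_comp]
  | _ => simp_all [Fm.subst, Tm.subst_subst]

theorem Fm.subst_id (φ : Fm) : φ.subst Tm.var id = φ := by
  induction φ with
  | all φ ih => rw [Fm.subst_all, liftTm_var, ih]
  | allS φ ih => rw [Fm.subst_allS, liftSet_id, ih]
  | _ => simp_all [Fm.subst, Tm.subst_var]

theorem Fm.wk_subst (φ : Fm) (e : ℕ → Tm) (f : ℕ → ℕ) :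
    φ.wk.subst (liftTm e) f = (φ.subst e f).wk := by
  simp only [Fm.wk, Fm.subst_subst]; rfl

theorem Fm.wkS_subst (φ : Fm) (e : ℕ → Tm) (f : ℕ → ℕ) :
    φ.wkS.subst e (liftSet f) = (φ.subst e f).wkS := by
  simp only [Fm.wkS, Fm.subst_subst, Tm.subst_var]; rfl

theorem Fm.inst_subst (φ : Fm) (t : Tm) (e : ℕ → Tm) (f : ℕ → ℕ) :
    (φ.inst t).subst e f = (φ.subst (liftTm e) f).inst (t.subst e) := by
  simp only [Fm.inst, Fm.subst_subst]
  congr 1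
  funext i
  cases i with
  | zero => rfl
  | succ i => exact ((e i).up_inst _).symm

theorem Fm.instS_subst (φ : Fm) (X : ℕ) (e : ℕ → Tm) (f : ℕ → ℕ) :
    (φ.instS X).subst e f = (φ.subst e (liftSet f)).instS (f X) := by
  simp only [Fm.instS, Fm.subst_subst, Tm.subst_var]
  congr 1
  funext i
  cases i <;> rfl

theorem Fm.subst_lift_inst (φ : Fm) (e : ℕ → Tm) (f : ℕ → ℕ) (t : Tm) :
    (φ.subst (liftTm e) f).inst t = φ.subst (scons t e) f := by
  simp only [Fm.inst, Fm.subst_subst]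
  congr 1
  funext i
  cases i with
  | zero => rfl
  | succ i => exact (e i).up_inst t

theorem Fm.subst_lift_instS (φ : Fm) (e : ℕ → Tm) (f : ℕ → ℕ) (X : ℕ) :
    (φ.subst e (liftSet f)).instS X = φ.subst e (scons X f) := by
  simp only [Fm.instS, Fm.subst_subst, Tm.subst_var]
  congr 1
  funext i
  cases i <;> rfl

theorem Tm.exists_var_bound (t : Tm) :
    ∃ n, ∀ e e' : ℕ → Tm, (∀ i < n, e i = e' i) → t.subst e = t.subst e' := by
  induction t with
  | var i => exact ⟨i + 1, fun e e' h => h i i.lt_succ_self⟩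
  | zero => exact ⟨0, fun _ _ _ => rfl⟩
  | one => exact ⟨0, fun _ _ _ => rfl⟩
  | add t u ht hu | mul t u ht hu =>
    obtain ⟨m, hm⟩ := ht
    obtain ⟨n, hn⟩ := hu
    refine ⟨max m n, fun e e' h => ?_⟩
    rw [Tm.subst, Tm.subst, hm e e' fun i hi => h i (lt_max_of_lt_left hi),
      hn e e' fun i hi => h i (lt_max_of_lt_right hi)]

/-- Only finitely many variables are relevant for a substitution. -/
theorem Fm.exists_var_bound (φ : Fm) :
    ∃ n, ∀ (e e' : ℕ → Tm) (f f' : ℕ → ℕ), (∀ i < n, e i = e' i) → (∀ i < n, f i = f' i) →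
      φ.subst e f = φ.subst e' f' := by
  induction φ with
  | eq t u | lt t u =>
    obtain ⟨m, hm⟩ := t.exists_var_bound
    obtain ⟨n, hn⟩ := u.exists_var_bound
    refine ⟨max m n, fun e e' f f' h _ => ?_⟩
    rw [Fm.subst, Fm.subst, hm e e' fun i hi => h i (lt_max_of_lt_left hi),
      hn e e' fun i hi => h i (lt_max_of_lt_right hi)]
  | mem t X =>
    obtain ⟨m, hm⟩ := t.exists_var_bound
    refine ⟨max m (X + 1), fun e e' f f' h h' => ?_⟩
    rw [Fm.subst, Fm.subst, hm e e' fun i hi => h i (lt_max_of_lt_left hi),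
      h' X (lt_max_of_lt_right X.lt_succ_self)]
  | cls t =>
    obtain ⟨m, hm⟩ := t.exists_var_bound
    exact ⟨m, fun e e' f f' h _ => by rw [Fm.subst, Fm.subst, hm e e' h]⟩
  | bot => exact ⟨0, fun _ _ _ _ _ _ => rfl⟩
  | imp φ ψ hφ hψ =>
    obtain ⟨m, hm⟩ := hφ
    obtain ⟨n, hn⟩ := hψ
    refine ⟨max m n, fun e e' f f' h h' => ?_⟩
    rw [Fm.subst, Fm.subst,
      hm e e' f f' (fun i hi => h i (lt_max_of_lt_left hi)) fun i hi => h' i (lt_max_of_lt_left hi),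
      hn e e' f f' (fun i hi => h i (lt_max_of_lt_right hi))
        fun i hi => h' i (lt_max_of_lt_right hi)]
  | all φ ih =>
    obtain ⟨m, hm⟩ := ih
    refine ⟨m, fun e e' f f' h h' => ?_⟩
    rw [Fm.subst_all, Fm.subst_all, hm (liftTm e) (liftTm e') f f' _ h']
    rintro (_ | i) hi
    · rfl
    · simp [liftTm, scons, h i (by omega)]
  | allS φ ih =>
    obtain ⟨m, hm⟩ := ih
    refine ⟨m, fun e e' f f' h h' => ?_⟩
    rw [Fm.subst_allS, Fm.subst_allS, hm e e' (liftSet f) (liftSet f') h]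
    rintro (_ | i) hi
    · rfl
    · simp [liftSet, scons, h' i (by omega)]

theorem exists_var_bound_list (Γ : List Fm) :
    ∃ n, ∀ φ ∈ Γ, ∀ (e e' : ℕ → Tm) (f f' : ℕ → ℕ), (∀ i < n, e i = e' i) →
      (∀ i < n, f i = f' i) → φ.subst e f = φ.subst e' f' := by
  induction Γ with
  | nil => exact ⟨0, by simp⟩
  | cons φ Γ ih =>
    obtain ⟨m, hm⟩ := φ.exists_var_bound
    obtain ⟨n, hn⟩ := ih
    refine ⟨max m n, ?_⟩
    intro ψ hψ e e' f f' h h'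
    rcases List.mem_cons.1 hψ with rfl | hψ
    · exact hm e e' f f' (fun i hi => h i (lt_max_of_lt_left hi))
        fun i hi => h' i (lt_max_of_lt_left hi)
    · exact hn ψ hψ e e' f f' (fun i hi => h i (lt_max_of_lt_right hi))
        fun i hi => h' i (lt_max_of_lt_right hi)

/-! ## Structural properties of derivations -/

section Derivations

variable {T : Set Fm}

theorem Derives.mono {Γ Δ : List Fm} {φ : Fm} (h : Derives T Γ φ) (hΔ : Γ ⊆ Δ) :
    Derives T Δ φ := by
  induction h generalizing Δ with
  | ax h e f => exact .ax h e f
  | hyp h => exact .hyp (hΔ h)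
  | impI _ ih => exact .impI (ih (List.cons_subset_cons _ hΔ))
  | impE _ _ ih ih' => exact .impE (ih hΔ) (ih' hΔ)
  | contra _ ih => exact .contra (ih (List.cons_subset_cons _ hΔ))
  | allI _ ih => exact .allI (ih (List.map_subset _ hΔ))
  | allE _ t ih => exact .allE (ih hΔ) t
  | allSI _ ih => exact .allSI (ih (List.map_subset _ hΔ))
  | allSE _ X ih => exact .allSE (ih hΔ) X
  | eqI t => exact .eqI t
  | eqE φ _ _ ih ih' => exact .eqE φ (ih hΔ) (ih' hΔ)

/-- Axioms may be used in every substitution instance, so only the quantifier rules need the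
commutation lemmas above. This is what turns a fresh free variable into an eigenvariable. -/
theorem Derives.subst {Γ : List Fm} {φ : Fm} (h : Derives T Γ φ) (e : ℕ → Tm) (f : ℕ → ℕ) :
    Derives T (Γ.map (Fm.subst e f)) (φ.subst e f) := by
  induction h generalizing e f with
  | ax h e' f' => rw [Fm.subst_subst]; exact .ax h _ _
  | hyp h => exact .hyp (List.mem_map_of_mem h)
  | impI _ ih => exact .impI (ih e f)
  | impE _ _ ih ih' => exact .impE (ih e f) (ih' e f)
  | contra _ ih => exact .contra (ih e f)
  | @allI Γ φ _ ih =>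
    refine .allI ?_
    have := ih (liftTm e) f
    simp only [List.map_map, Function.comp_def, Fm.wk_subst] at this
    simp only [List.map_map, Function.comp_def]
    exact this
  | allE _ t ih => rw [Fm.inst_subst]; exact .allE (ih e f) _
  | allSI _ ih =>
    refine .allSI ?_
    have := ih e (liftSet f)
    simp only [List.map_map, Function.comp_def, Fm.wkS_subst] at this
    simp only [List.map_map, Function.comp_def]
    exact this
  | allSE _ X ih => rw [Fm.instS_subst]; exact .allSE (ih e f) _
  | eqI t => exact .eqI _
  | eqE φ _ _ ih ih' =>
    have := ih' e f
    rw [Fm.inst_subst] at this ⊢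
    exact .eqE _ (ih e f) this

theorem Derives.ex_falso {Γ : List Fm} (h : Derives T Γ .bot) (φ : Fm) : Derives T Γ φ :=
  .contra (h.mono (List.subset_cons_self _ _))

/-! ## Henkin extensions -/

def Consistent (T : Set Fm) (Γ : List Fm) : Prop := ¬ Derives T Γ .bot

theorem Consistent.or_neg {Γ : List Fm} (h : Consistent T Γ) (φ : Fm) :
    Consistent T (φ :: Γ) ∨ Consistent T (φ.neg :: Γ) := by
  by_contra hc
  simp only [Consistent, not_or, not_not] at hc
  exact h (.impE (.impI hc.1) (.contra hc.2))

/-- A variable `n` beyond all relevant ones serves as witness. If adding it were inconsistent,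
`φ.inst ♯n` would be derivable; renaming `n` to `0` and shifting the other variables gives the
premise of `allI`, against the assumption `φ.all.neg`. -/
theorem Consistent.exists_witness {Γ : List Fm} {φ : Fm}
    (h : Consistent T (φ.all.neg :: Γ)) :
    ∃ k, Consistent T ((φ.inst ♯k).neg :: φ.all.neg :: Γ) := by
  obtain ⟨n, hn⟩ := exists_var_bound_list (φ :: φ.all.neg :: Γ)
  refine ⟨n, fun hd => h ?_⟩
  have hd := (Derives.contra hd).subst (fun i => if i = n then ♯0 else ♯(i + 1)) id
  refine .impE (.hyp (List.mem_cons_self ..)) (.allI ?_)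
  convert hd using 1
  · refine List.map_congr_left fun ψ hψ => hn ψ (List.mem_cons_of_mem _ hψ) _ _ _ _ ?_ fun _ _ => rfl
    intro i hi
    simp [hi.ne]
  · rw [Fm.inst, Fm.subst_subst]
    conv_lhs => rw [← φ.subst_id]
    refine hn φ (List.mem_cons_self ..) _ _ _ _ ?_ fun _ _ => rfl
    rintro (_ | i) hi
    · simp [scons, Tm.subst]
    · simp [scons, Tm.subst, show i ≠ n by omega]

theorem Consistent.exists_witnessS {Γ : List Fm} {φ : Fm}
    (h : Consistent T (φ.allS.neg :: Γ)) :
    ∃ k, Consistent T ((φ.instS k).neg :: φ.allS.neg :: Γ) := by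
  obtain ⟨n, hn⟩ := exists_var_bound_list (φ :: φ.allS.neg :: Γ)
  refine ⟨n, fun hd => h ?_⟩
  have hd := (Derives.contra hd).subst Tm.var (fun i => if i = n then 0 else i + 1)
  refine .impE (.hyp (List.mem_cons_self ..)) (.allSI ?_)
  convert hd using 1
  · refine List.map_congr_left fun ψ hψ => hn ψ (List.mem_cons_of_mem _ hψ) _ _ _ _ (fun _ _ => rfl) ?_
    intro i hi
    simp [hi.ne]
  · rw [Fm.instS, Fm.subst_subst]
    conv_lhs => rw [← φ.subst_id]
    refine hn φ (List.mem_cons_self ..) _ _ _ _ (fun _ _ => rfl) ?_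
    rintro (_ | i) hi
    · simp [scons]
    · simp [scons, show i ≠ n by omega]

/-- `Δ` decides `φ`, with a witness if `φ` is a refuted universal formula. -/
def Decides (Δ : List Fm) (φ : Fm) : Prop :=
  φ ∈ Δ ∨ φ.neg ∈ Δ ∧ (∀ ψ, φ = .all ψ → ∃ k, (ψ.inst ♯k).neg ∈ Δ) ∧
    ∀ ψ, φ = .allS ψ → ∃ k, (ψ.instS k).neg ∈ Δ

theorem Consistent.exists_decides {Γ : List Fm} (h : Consistent T Γ) (φ : Fm) :
    ∃ Δ, Γ ⊆ Δ ∧ Consistent T Δ ∧ Decides Δ φ := by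
  rcases h.or_neg φ with h | h
  · exact ⟨_, List.subset_cons_self _ _, h, .inl (List.mem_cons_self ..)⟩
  by_cases h1 : ∃ ψ, φ = .all ψ
  · obtain ⟨ψ, rfl⟩ := h1
    obtain ⟨k, hk⟩ := h.exists_witness
    refine ⟨_, ?_, hk, .inr ⟨by simp, ?_, by simp⟩⟩
    · intro χ hχ
      simp [hχ]
    · rintro _ ⟨rfl⟩
      exact ⟨k, by simp⟩
  by_cases h2 : ∃ ψ, φ = .allS ψ
  · obtain ⟨ψ, rfl⟩ := h2
    obtain ⟨k, hk⟩ := h.exists_witnessS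
    refine ⟨_, ?_, hk, .inr ⟨by simp, by simp, ?_⟩⟩
    · intro χ hχ
      simp [hχ]
    · rintro _ ⟨rfl⟩
      exact ⟨k, by simp⟩
  exact ⟨_, List.subset_cons_self _ _, h, .inr ⟨List.mem_cons_self ..,
    fun ψ hψ => (h1 ⟨ψ, hψ⟩).elim, fun ψ hψ => (h2 ⟨ψ, hψ⟩).elim⟩⟩

end Derivations

/-! ## Countability of the language -/

/-- The codes serve only to make the language countable, so that the Henkin construction can run
along an enumeration by `ℕ`. -/
def Tm.code : Tm → ℕ
  | .var i => Nat.pair 0 i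
  | .zero => Nat.pair 1 0
  | .one => Nat.pair 2 0
  | .add t u => Nat.pair 3 (Nat.pair t.code u.code)
  | .mul t u => Nat.pair 4 (Nat.pair t.code u.code)

theorem Tm.code_injective : Function.Injective Tm.code := by
  intro t
  induction t with
  | var i => rintro (_ | _) <;> simp [Tm.code, Nat.pair_eq_pair]
  | zero => rintro (_ | _) <;> simp [Tm.code, Nat.pair_eq_pair]
  | one => rintro (_ | _) <;> simp [Tm.code, Nat.pair_eq_pair]
  | add t u ht hu | mul t u ht hu =>
    rintro (_ | _) <;> simp only [Tm.code, Nat.pair_eq_pair] <;> try simp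
    exact fun h h' => ⟨ht h, hu h'⟩

def Fm.code : Fm → ℕ
  | .eq t u => Nat.pair 0 (Nat.pair t.code u.code)
  | .lt t u => Nat.pair 1 (Nat.pair t.code u.code)
  | .mem t X => Nat.pair 2 (Nat.pair t.code X)
  | .cls t => Nat.pair 3 t.code
  | .bot => Nat.pair 4 0
  | .imp φ ψ => Nat.pair 5 (Nat.pair φ.code ψ.code)
  | .all φ => Nat.pair 6 φ.code
  | .allS φ => Nat.pair 7 φ.code

theorem Fm.code_injective : Function.Injective Fm.code := by
  intro φ
  induction φ with
  | imp φ ψ hφ hψ =>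
    rintro (_ | _) <;> simp only [Fm.code, Nat.pair_eq_pair] <;> try simp
    exact fun h h' => ⟨hφ h, hψ h'⟩
  | all φ ih | allS φ ih =>
    rintro (_ | _) <;> simp only [Fm.code, Nat.pair_eq_pair] <;> try simp
    exact fun h => ih h
  | _ => rintro (_ | _) <;> simp [Fm.code, Nat.pair_eq_pair, Tm.code_injective.eq_iff]

instance : Countable Fm := Fm.code_injective.countable

instance : Nonempty Fm := ⟨.bot⟩

/-! ## Structures -/

/-- A structure for the two-sorted language. -/
structure Str where
  Dom : Type
  Sets : Type
  zero : Dom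
  one : Dom
  add : Dom → Dom → Dom
  mul : Dom → Dom → Dom
  lt : Dom → Dom → Prop
  mem : Dom → Sets → Prop
  cls : Dom → Prop
  -- Formulas without set variables are still evaluated under an assignment of sets, so at least one
  -- set is needed.
  nonempty : Nonempty Sets

namespace Str
variable (N : Str)
instance : Zero N.Dom := ⟨N.zero⟩
instance : One N.Dom := ⟨N.one⟩
instance : Add N.Dom := ⟨N.add⟩
instance : Mul N.Dom := ⟨N.mul⟩
instance : LT N.Dom := ⟨N.lt⟩
instance : Membership N.Dom N.Sets := ⟨fun X x => N.mem x X⟩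
end Str

/-- The value of a term. -/
def Tm.val {N : Str} (e : ℕ → N.Dom) : Tm → N.Dom
  | .var i => e i
  | .zero => 0
  | .one => 1
  | .add t u => t.val e + u.val e
  | .mul t u => t.val e * u.val e

/-- Satisfaction. -/
def Fm.Holds {N : Str} : (ℕ → N.Dom) → (ℕ → N.Sets) → Fm → Prop
  | e, _, .eq t u => t.val e = u.val e
  | e, _, .lt t u => t.val e < u.val e
  | e, f, .mem t X => t.val e ∈ f X
  | e, _, .cls t => N.cls (t.val e)
  | _, _, .bot => False
  | e, f, .imp φ ψ => φ.Holds e f → ψ.Holds e f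
  | e, f, .all φ => ∀ x, φ.Holds (scons x e) f
  | e, f, .allS φ => ∀ X, φ.Holds e (scons X f)

/-- All substitution instances of the axioms in `T` are true in `N`. -/
def Str.Models (N : Str) (T : Set Fm) : Prop := ∀ φ ∈ T, ∀ e f, φ.Holds (N := N) e f

/-! ## Completeness -/

/-- A complete Henkin theory. -/
structure IsHenkin (T : Set Fm) (Δ : Set Fm) : Prop where
  ax : ∀ φ ∈ T, ∀ e f, φ.subst e f ∈ Δ
  bot : Fm.bot ∉ Δ
  imp : ∀ {φ ψ}, (φ ➔ ψ) ∈ Δ ↔ (φ ∈ Δ → ψ ∈ Δ)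
  all : ∀ {φ}, Fm.all φ ∈ Δ ↔ ∀ t, φ.inst t ∈ Δ
  allS : ∀ {φ}, Fm.allS φ ∈ Δ ↔ ∀ X, φ.instS X ∈ Δ
  eqI : ∀ t, (t ≐ t) ∈ Δ
  eqE : ∀ {t u} (φ : Fm), (t ≐ u) ∈ Δ → φ.inst t ∈ Δ → φ.inst u ∈ Δ

/-- A chain of consistent finite contexts decides one formula of an enumeration at each stage, with
a witness for each refuted universal formula. The deductive closure of the union is the desired
theory. -/
theorem Consistent.exists_isHenkin {T : Set Fm} {Γ : List Fm} (h : Consistent T Γ) :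
    ∃ Δ, IsHenkin T Δ ∧ ∀ φ ∈ Γ, φ ∈ Δ := by
  obtain ⟨enum, henum⟩ := exists_surjective_nat Fm
  choose! next hsub hcon hdec using
    fun (Γ : List Fm) (φ : Fm) (h : Consistent T Γ) => h.exists_decides φ
  let chain : ℕ → List Fm := fun n => n.rec Γ fun k Γ' => next Γ' (enum k)
  have hchain : ∀ n, Consistent T (chain n) := by
    intro n
    induction n with
    | zero => exact h
    | succ n ih => exact hcon _ _ ih
  have hmono : ∀ m n, m ≤ n → chain m ⊆ chain n := by
    intro m n hmn
    induction hmn with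
    | refl => exact fun _ h => h
    | step _ ih => exact fun _ h => hsub _ _ (hchain _) (ih h)
  have hdecides : ∀ φ, ∃ n, Decides (chain n) φ := by
    intro φ
    obtain ⟨n, rfl⟩ := henum φ
    exact ⟨n + 1, hdec _ _ (hchain n)⟩
  let Δ : Set Fm := {φ | ∃ n, Derives T (chain n) φ}
  have hmem : ∀ {φ n}, φ ∈ chain n → φ ∈ Δ := fun h => ⟨_, .hyp h⟩
  have hmp : ∀ {φ ψ}, (φ ➔ ψ) ∈ Δ → φ ∈ Δ → ψ ∈ Δ := by
    rintro φ ψ ⟨m, hm⟩ ⟨n, hn⟩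
    exact ⟨max m n, .impE (hm.mono (hmono _ _ (le_max_left ..)))
      (hn.mono (hmono _ _ (le_max_right ..)))⟩
  have hbot : Fm.bot ∉ Δ := fun ⟨n, hn⟩ => hchain n hn
  have hneg : ∀ {φ}, φ ∉ Δ → φ.neg ∈ Δ := by
    intro φ hφ
    obtain ⟨n, hn | hn⟩ := hdecides φ
    · exact (hφ (hmem hn)).elim
    · exact hmem hn.1
  refine ⟨Δ, ⟨fun φ hφ e f => ⟨0, .ax hφ e f⟩, hbot, ⟨hmp, ?_⟩, ⟨?_, ?_⟩, ⟨?_, ?_⟩,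
    fun t => ⟨0, .eqI t⟩, ?_⟩, fun φ hφ => hmem (n := 0) hφ⟩
  · intro himp
    rename_i φ ψ
    by_cases hφ : φ ∈ Δ
    · obtain ⟨n, hn⟩ := himp hφ
      exact ⟨n, .impI (hn.mono (List.subset_cons_self _ _))⟩
    · obtain ⟨n, hn⟩ := hneg hφ
      exact ⟨n, .impI (.ex_falso (.impE (hn.mono (List.subset_cons_self _ _))
        (.hyp (List.mem_cons_self ..))) _)⟩
  · rintro ⟨n, hn⟩ t
    exact ⟨n, .allE hn t⟩
  · intro hφ
    rename_i φ
    obtain ⟨n, hn | hn⟩ := hdecides φ.all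
    · exact hmem hn
    · obtain ⟨k, hk⟩ := hn.2.1 φ rfl
      exact (hbot (hmp (hmem hk) (hφ _))).elim
  · rintro ⟨n, hn⟩ X
    exact ⟨n, .allSE hn X⟩
  · intro hφ
    rename_i φ
    obtain ⟨n, hn | hn⟩ := hdecides φ.allS
    · exact hmem hn
    · obtain ⟨k, hk⟩ := hn.2.2 φ rfl
      exact (hbot (hmp (hmem hk) (hφ _))).elim
  · rintro t u φ ⟨m, hm⟩ ⟨n, hn⟩
    exact ⟨max m n, .eqE φ (hm.mono (hmono _ _ (le_max_left ..)))
      (hn.mono (hmono _ _ (le_max_right ..)))⟩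

namespace IsHenkin

variable {T Δ : Set Fm}

theorem eq_symm (hΔ : IsHenkin T Δ) {t u : Tm} (h : (t ≐ u) ∈ Δ) : (u ≐ t) ∈ Δ := by
  have := hΔ.eqE (♯0 ≐ t.up 1) h
  simp only [Fm.inst, Fm.subst, Tm.up_inst] at this
  exact this (hΔ.eqI t)

theorem eq_trans (hΔ : IsHenkin T Δ) {t u v : Tm} (h : (t ≐ u) ∈ Δ) (h' : (u ≐ v) ∈ Δ) : (t ≐ v) ∈ Δ := by
  have := hΔ.eqE (t.up 1 ≐ ♯0) h'
  simp only [Fm.inst, Fm.subst, Tm.up_inst] at this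
  exact this h

/-- Provable equality. -/
def setoid (hΔ : IsHenkin T Δ) : Setoid Tm where
  r t u := (t ≐ u) ∈ Δ
  iseqv := ⟨hΔ.eqI, hΔ.eq_symm, hΔ.eq_trans⟩

theorem add_congr (hΔ : IsHenkin T Δ) {t t' u u' : Tm} (h : (t ≐ t') ∈ Δ) (h' : (u ≐ u') ∈ Δ) :
    (t.add u ≐ t'.add u') ∈ Δ := by
  have h1 := hΔ.eqE ((t.up 1).add (u.up 1) ≐ Tm.add ♯0 (u.up 1)) h
  have h2 := hΔ.eqE ((t.up 1).add (u.up 1) ≐ (t'.up 1).add ♯0) h'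
  simp only [Fm.inst, Fm.subst, Tm.subst, Tm.up_inst] at h1 h2
  exact h2 (h1 (hΔ.eqI _))

theorem mul_congr (hΔ : IsHenkin T Δ) {t t' u u' : Tm} (h : (t ≐ t') ∈ Δ) (h' : (u ≐ u') ∈ Δ) :
    (t.mul u ≐ t'.mul u') ∈ Δ := by
  have h1 := hΔ.eqE ((t.up 1).mul (u.up 1) ≐ Tm.mul ♯0 (u.up 1)) h
  have h2 := hΔ.eqE ((t.up 1).mul (u.up 1) ≐ (t'.up 1).mul ♯0) h'
  simp only [Fm.inst, Fm.subst, Tm.subst, Tm.up_inst] at h1 h2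
  exact h2 (h1 (hΔ.eqI _))

theorem lt_congr (hΔ : IsHenkin T Δ) {t t' u u' : Tm} (h : (t ≐ t') ∈ Δ) (h' : (u ≐ u') ∈ Δ)
    (hlt : (t ≺ u) ∈ Δ) : (t' ≺ u') ∈ Δ := by
  have h1 := hΔ.eqE (♯0 ≺ u.up 1) h
  have h2 := hΔ.eqE (t'.up 1 ≺ ♯0) h'
  simp only [Fm.inst, Fm.subst, Tm.up_inst] at h1 h2
  exact h2 (h1 hlt)

theorem mem_congr (hΔ : IsHenkin T Δ) {t t' : Tm} (X : ℕ) (h : (t ≐ t') ∈ Δ) (hm : (t ε X) ∈ Δ) : (t' ε X) ∈ Δ :=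
  hΔ.eqE (♯0 ε X) h hm

theorem cls_congr (hΔ : IsHenkin T Δ) {t t' : Tm} (h : (t ≐ t') ∈ Δ) (hm : Fm.cls t ∈ Δ) : Fm.cls t' ∈ Δ :=
  hΔ.eqE (Fm.cls ♯0) h hm

/-- The term model. -/
def model (hΔ : IsHenkin T Δ) : Str where
  Dom := Quotient hΔ.setoid
  Sets := ℕ
  zero := Quotient.mk _ .zero
  one := Quotient.mk _ .one
  add := Quotient.map₂ Tm.add fun _ _ h _ _ h' => hΔ.add_congr h h'
  mul := Quotient.map₂ Tm.mul fun _ _ h _ _ h' => hΔ.mul_congr h h'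
  lt := Quotient.lift₂ (fun t u => (t ≺ u) ∈ Δ) fun _ _ _ _ h h' => propext
    ⟨hΔ.lt_congr h h', hΔ.lt_congr (hΔ.eq_symm h) (hΔ.eq_symm h')⟩
  mem x X := Quotient.lift (fun t => (t ε X) ∈ Δ) (fun _ _ h => propext
    ⟨hΔ.mem_congr X h, hΔ.mem_congr X (hΔ.eq_symm h)⟩) x
  cls := Quotient.lift (fun t => Fm.cls t ∈ Δ) fun _ _ h => propext
    ⟨hΔ.cls_congr h, hΔ.cls_congr (hΔ.eq_symm h)⟩
  nonempty := ⟨(0 : ℕ)⟩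

/-- The element of the term model denoted by a term. -/
def den (hΔ : IsHenkin T Δ) (t : Tm) : hΔ.model.Dom := Quotient.mk hΔ.setoid t

theorem den_surjective (hΔ : IsHenkin T Δ) : Function.Surjective hΔ.den := Quotient.mk_surjective

theorem val_den (hΔ : IsHenkin T Δ) (t : Tm) (e : ℕ → Tm) :
    t.val (fun i => hΔ.den (e i)) = hΔ.den (t.subst e) := by
  induction t with
  | add t u ht hu | mul t u ht hu => simp only [Tm.val, ht, hu]; rfl
  | _ => rfl

/-- The truth lemma. Every element of the model is denoted by a term and every set is a set
variable, so the quantifier cases are the clauses `all` and `allS` of a Henkin theory. -/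
theorem holds_iff (hΔ : IsHenkin T Δ) (φ : Fm) (e : ℕ → Tm) (f : ℕ → ℕ) :
    φ.Holds (N := hΔ.model) (fun i => hΔ.den (e i)) f ↔ φ.subst e f ∈ Δ := by
  induction φ generalizing e f with
  | eq t u =>
    simp only [Fm.Holds, val_den, Fm.subst]
    exact Quotient.eq (r := hΔ.setoid)
  | lt t u => simp only [Fm.Holds, val_den, Fm.subst]; rfl
  | mem t X => simp only [Fm.Holds, val_den, Fm.subst]; rfl
  | cls t => simp only [Fm.Holds, val_den, Fm.subst]; rfl
  | bot => simp only [Fm.Holds, Fm.subst, hΔ.bot]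
  | imp φ ψ hφ hψ => simp only [Fm.Holds, Fm.subst, hΔ.imp, hφ, hψ]
  | all φ ih =>
    simp only [Fm.Holds, Fm.subst_all, hΔ.all, Fm.subst_lift_inst, ← ih, hΔ.den_surjective.forall]
    refine forall_congr' fun t => ?_
    rw [show scons (hΔ.den t) (fun i => hΔ.den (e i)) = fun i => hΔ.den (scons t e i) from
      funext fun i => by cases i <;> rfl]
  | allS φ ih =>
    simp only [Fm.Holds, Fm.subst_allS, hΔ.allS, Fm.subst_lift_instS, ← ih]
    rfl

theorem model_models (hΔ : IsHenkin T Δ) : hΔ.model.Models T := by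
  intro φ hφ e f
  obtain ⟨e', rfl⟩ := hΔ.den_surjective.comp_left e
  exact (hΔ.holds_iff φ e' f).2 (hΔ.ax φ hφ e' f)

end IsHenkin

/-- The completeness theorem. -/
theorem proves_of_models {T : Set Fm} {φ : Fm}
    (h : ∀ N : Str, N.Models T → ∀ e f, φ.Holds (N := N) e f) : Proves T φ := by
  by_contra hφ
  have hcon : Consistent T [φ.neg] := fun hd => hφ (.contra hd)
  obtain ⟨Δ, hΔ, hmem⟩ := hcon.exists_isHenkin
  have h1 := (hΔ.holds_iff φ Tm.var id).1 (h hΔ.model hΔ.model_models _ _)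
  rw [Fm.subst_id] at h1
  exact hΔ.bot (hΔ.imp.1 (hmem φ.neg (by simp)) h1)

/-! ## Evaluation of terms and formulas -/

section Evaluation

variable {N : Str} (e : ℕ → N.Dom) (f : ℕ → N.Sets)

theorem scons_zero {α : Type} (a : α) (g : ℕ → α) : scons a g 0 = a := rfl
theorem scons_succ {α : Type} (a : α) (g : ℕ → α) (i : ℕ) : scons a g (i + 1) = g i := rfl

theorem Tm.val_var (i : ℕ) : (♯i).val e = e i := rfl
theorem Tm.val_zero : (0 : Tm).val e = 0 := rfl
theorem Tm.val_one : (1 : Tm).val e = 1 := rfl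
theorem Tm.val_add (t u : Tm) : (t + u).val e = t.val e + u.val e := rfl
theorem Tm.val_mul (t u : Tm) : (t * u).val e = t.val e * u.val e := rfl

theorem Tm.val_subst (t : Tm) (s : ℕ → Tm) : (t.subst s).val e = t.val fun i => (s i).val e := by
  induction t <;> simp_all [Tm.subst, Tm.val]

theorem Tm.val_up (t : Tm) (k : ℕ) : (t.up k).val e = t.val fun i => e (i + k) :=
  t.val_subst e _

theorem Fm.holds_eq (t u : Tm) : (t ≐ u).Holds e f ↔ t.val e = u.val e := Iff.rfl
theorem Fm.holds_lt (t u : Tm) : (t ≺ u).Holds e f ↔ t.val e < u.val e := Iff.rfl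
theorem Fm.holds_mem (t : Tm) (X : ℕ) : (t ε X).Holds e f ↔ t.val e ∈ f X := Iff.rfl
theorem Fm.holds_imp (φ ψ : Fm) : (φ ➔ ψ).Holds e f ↔ (φ.Holds e f → ψ.Holds e f) := Iff.rfl
theorem Fm.holds_all (φ : Fm) : φ.all.Holds e f ↔ ∀ x, φ.Holds (scons x e) f := Iff.rfl
theorem Fm.holds_allS (φ : Fm) : φ.allS.Holds e f ↔ ∀ X, φ.Holds e (scons X f) := Iff.rfl
theorem Fm.holds_neg (φ : Fm) : φ.neg.Holds e f ↔ ¬ φ.Holds e f := Iff.rfl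

theorem Fm.holds_and (φ ψ : Fm) : (φ ⋏ ψ).Holds e f ↔ φ.Holds e f ∧ ψ.Holds e f := by
  simp [Fm.and, Fm.holds_neg, Fm.holds_imp]

theorem Fm.holds_or (φ ψ : Fm) : (φ ⋎ ψ).Holds e f ↔ φ.Holds e f ∨ ψ.Holds e f := by
  simp only [Fm.or, Fm.holds_neg, Fm.holds_imp]; tauto

theorem Fm.holds_iff (φ ψ : Fm) : (φ ⟺ ψ).Holds e f ↔ (φ.Holds e f ↔ ψ.Holds e f) := by
  simp only [Fm.iff, Fm.holds_and, Fm.holds_imp]; tauto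

theorem Fm.holds_ex (φ : Fm) : φ.ex.Holds e f ↔ ∃ x, φ.Holds (scons x e) f := by
  simp [Fm.ex, Fm.holds_neg, Fm.holds_all]

theorem Fm.holds_exS (φ : Fm) : φ.exS.Holds e f ↔ ∃ X, φ.Holds e (scons X f) := by
  simp [Fm.exS, Fm.holds_neg, Fm.holds_allS]

theorem Fm.holds_subst (φ : Fm) (s : ℕ → Tm) (g : ℕ → ℕ) :
    (φ.subst s g).Holds e f ↔ φ.Holds (fun i => (s i).val e) fun i => f (g i) := by
  induction φ generalizing e f s g with
  | eq t u | lt t u | mem t u | cls t => simp only [Fm.subst, Fm.Holds, Tm.val_subst]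
  | bot => rfl
  | imp φ ψ hφ hψ => simp only [Fm.subst, Fm.Holds, hφ, hψ]
  | all φ ih =>
    simp only [Fm.subst_all, Fm.Holds, ih]
    refine forall_congr' fun x => ?_
    rw [show (fun i => (liftTm s i).val (scons x e)) = scons x fun i => (s i).val e from
      funext fun i => by
        cases i
        · rfl
        · exact Tm.val_up _ _ _]
  | allS φ ih =>
    simp only [Fm.subst_allS, Fm.Holds, ih]
    refine forall_congr' fun X => ?_
    rw [show (fun i => scons X f (liftSet g i)) = scons X fun i => f (g i) from
      funext fun i => by cases i <;> rfl]

theorem Fm.holds_at (φ : Fm) (k s : ℕ) (t : Tm) :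
    (φ.at k s t).Holds e f ↔ φ.Holds (scons (t.val e) fun i => e (i + k)) fun i => f (i + s) := by
  rw [Fm.at, Fm.holds_subst]
  rw [show (fun i => (scons t (fun i => ♯(i + k)) i).val e) = scons (t.val e) fun i => e (i + k) from
    funext fun i => by cases i <;> rfl]

end Evaluation

theorem IsBounded.subst {φ : Fm} (h : IsBounded φ) (s : ℕ → Tm) (g : ℕ → ℕ) :
    IsBounded (φ.subst s g) := by
  induction h generalizing s g with
  | eq t u => exact .eq _ _
  | lt t u => exact .lt _ _
  | mem t X => exact .mem _ _
  | bot => exact .bot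
  | imp _ _ ih ih' => exact .imp (ih s g) (ih' s g)
  | ball t _ ih =>
    have : (t.up 1).subst (liftTm s) = (t.subst s).up 1 := by
      simp only [Tm.up, Tm.subst_subst]; rfl
    rw [Fm.subst_all, Fm.subst, Fm.subst, this]
    exact .ball _ (ih _ _)

/-! ## Definable predicates

A predicate of assignments `ℕ → N.Dom` is `D0` if it is defined by a bounded formula with
parameters, and `D1` if it is defined by a `Σ⁰₁` formula with parameters. -/

/-- `a` and `b` interleaved. -/
def mix {α : Type} (a b : ℕ → α) (i : ℕ) : α := if i % 2 = 0 then a (i / 2) else b (i / 2)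

theorem mix_even {α : Type} (a b : ℕ → α) (i : ℕ) : mix a b (2 * i) = a i := by simp [mix]

theorem mix_odd {α : Type} (a b : ℕ → α) (i : ℕ) : mix a b (2 * i + 1) = b i := by
  simp [mix, Nat.add_mod, show (2 * i + 1) / 2 = i by omega]

/-- The assignment that gives each variable the value of another variable or a fixed value. -/
def assign {α : Type} (s : ℕ → ℕ ⊕ α) (e : ℕ → α) (i : ℕ) : α := (s i).elim e id

/-- The function `g` is given by a term with parameters. -/
class Poly {N : Str} (g : (ℕ → N.Dom) → N.Dom) : Prop where
  out : ∃ (t : Tm) (s : ℕ → ℕ ⊕ N.Dom), ∀ e, g e = t.val (assign s e)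

/-- The predicate `P` is given by a bounded formula with parameters. -/
class D0 {N : Str} (P : (ℕ → N.Dom) → Prop) : Prop where
  out : ∃ (θ : Fm) (s : ℕ → ℕ ⊕ N.Dom) (f : ℕ → N.Sets), IsBounded θ ∧
    ∀ e, P e ↔ θ.Holds (assign s e) f

/-- The predicate `P` is given by a `Σ⁰₁` formula with parameters. -/
class D1 {N : Str} (P : (ℕ → N.Dom) → Prop) : Prop where
  out : ∃ Q : (ℕ → N.Dom) → Prop, D0 Q ∧ ∀ e, P e ↔ ∃ x, Q (scons x e)

section Definability

variable {N : Str}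

theorem assign_mix_even {α : Type} (s s' : ℕ → ℕ ⊕ α) (e : ℕ → α) (i : ℕ) :
    assign (mix s s') e (2 * i) = assign s e i := by simp [assign, mix_even]

theorem assign_mix_odd {α : Type} (s s' : ℕ → ℕ ⊕ α) (e : ℕ → α) (i : ℕ) :
    assign (mix s s') e (2 * i + 1) = assign s' e i := by simp [assign, mix_odd]

theorem Tm.val_mix_even (t : Tm) (s s' : ℕ → ℕ ⊕ N.Dom) (e : ℕ → N.Dom) :
    (t.subst fun i => ♯(2 * i)).val (assign (mix s s') e) = t.val (assign s e) := by
  simp only [Tm.val_subst, Tm.val_var, assign_mix_even]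

theorem Tm.val_mix_odd (t : Tm) (s s' : ℕ → ℕ ⊕ N.Dom) (e : ℕ → N.Dom) :
    (t.subst fun i => ♯(2 * i + 1)).val (assign (mix s s') e) = t.val (assign s' e) := by
  simp only [Tm.val_subst, Tm.val_var, assign_mix_odd]

theorem Fm.holds_mix_even (θ : Fm) (s s' : ℕ → ℕ ⊕ N.Dom) (f f' : ℕ → N.Sets) (e : ℕ → N.Dom) :
    (θ.subst (fun i => ♯(2 * i)) fun i => 2 * i).Holds (assign (mix s s') e) (mix f f') ↔
      θ.Holds (assign s e) f := by
  simp only [Fm.holds_subst, Tm.val_var, assign_mix_even, mix_even]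

theorem Fm.holds_mix_odd (θ : Fm) (s s' : ℕ → ℕ ⊕ N.Dom) (f f' : ℕ → N.Sets) (e : ℕ → N.Dom) :
    (θ.subst (fun i => ♯(2 * i + 1)) fun i => 2 * i + 1).Holds (assign (mix s s') e) (mix f f') ↔
      θ.Holds (assign s' e) f' := by
  simp only [Fm.holds_subst, Tm.val_var, assign_mix_odd, mix_odd]

/-- The parameters of the two terms are interleaved, so that one assignment serves both. -/
theorem Poly.exists_common {g g' : (ℕ → N.Dom) → N.Dom} (h : Poly g) (h' : Poly g') :
    ∃ (t t' : Tm) (s : ℕ → ℕ ⊕ N.Dom),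
      (∀ e, g e = t.val (assign s e)) ∧ ∀ e, g' e = t'.val (assign s e) := by
  obtain ⟨t, s, ht⟩ := h
  obtain ⟨t', s', ht'⟩ := h'
  exact ⟨_, _, mix s s', fun e => by rw [ht, t.val_mix_even], fun e => by rw [ht', t'.val_mix_odd]⟩

theorem D0.exists_common {P P' : (ℕ → N.Dom) → Prop} (h : D0 P) (h' : D0 P') :
    ∃ (θ θ' : Fm) (s : ℕ → ℕ ⊕ N.Dom) (f : ℕ → N.Sets), IsBounded θ ∧ IsBounded θ' ∧
      (∀ e, P e ↔ θ.Holds (assign s e) f) ∧ ∀ e, P' e ↔ θ'.Holds (assign s e) f := by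
  obtain ⟨θ, s, f, hθ, h⟩ := h
  obtain ⟨θ', s', f', hθ', h'⟩ := h'
  exact ⟨_, _, mix s s', mix f f', hθ.subst _ _, hθ'.subst _ _,
    fun e => by rw [h, θ.holds_mix_even], fun e => by rw [h', θ'.holds_mix_odd]⟩

theorem D0.congr {P P' : (ℕ → N.Dom) → Prop} (h : D0 P) (hP : ∀ e, P' e ↔ P e) : D0 P' := by
  rwa [show P' = P from funext fun e => propext (hP e)]

theorem D1.congr {P P' : (ℕ → N.Dom) → Prop} (h : D1 P) (hP : ∀ e, P' e ↔ P e) : D1 P' := by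
  rwa [show P' = P from funext fun e => propext (hP e)]

/-- From here on, definability is found by instance search along the shape of a predicate; this is
how the hypotheses of induction and comprehension are discharged later. -/
instance Poly.const (a : N.Dom) : Poly fun _ : ℕ → N.Dom => a :=
  ⟨♯0, fun _ => .inr a, fun _ => rfl⟩

instance Poly.var (i : ℕ) : Poly fun e : ℕ → N.Dom => e i := ⟨♯i, fun i => .inl i, fun _ => rfl⟩

instance Poly.add {g g' : (ℕ → N.Dom) → N.Dom} [h : Poly g] [h' : Poly g'] :
    Poly fun e => g e + g' e := by
  obtain ⟨t, t', s, h, h'⟩ := h.exists_common h'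
  exact ⟨t + t', s, fun e => by simp only [h, h', Tm.val_add]⟩

instance Poly.mul {g g' : (ℕ → N.Dom) → N.Dom} [h : Poly g] [h' : Poly g'] :
    Poly fun e => g e * g' e := by
  obtain ⟨t, t', s, h, h'⟩ := h.exists_common h'
  exact ⟨t * t', s, fun e => by simp only [h, h', Tm.val_mul]⟩

/-- Renaming of variables, some of which may be given fixed values. -/
theorem Poly.assign {g : (ℕ → N.Dom) → N.Dom} (h : Poly g) (r : ℕ → ℕ ⊕ N.Dom) :
    Poly fun e => g (assign r e) := by
  obtain ⟨t, s, h⟩ := h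
  refine ⟨t, fun i => (s i).elim r .inr, fun e => ?_⟩
  rw [h]
  congr 1
  funext i
  simp only [SOA.assign]
  cases s i <;> rfl

theorem D0.assign {P : (ℕ → N.Dom) → Prop} (h : D0 P) (r : ℕ → ℕ ⊕ N.Dom) :
    D0 fun e => P (assign r e) := by
  obtain ⟨θ, s, f, hθ, h⟩ := h
  refine ⟨θ, fun i => (s i).elim r .inr, f, hθ, fun e => ?_⟩
  rw [h]
  congr! 1
  funext i
  simp only [SOA.assign]
  cases s i <;> rfl

theorem Poly.tail {g : (ℕ → N.Dom) → N.Dom} [h : Poly g] :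
    Poly fun e => g fun i => e (i + 1) := h.assign fun i => .inl (i + 1)

theorem D0.tail {P : (ℕ → N.Dom) → Prop} [h : D0 P] :
    D0 fun e => P fun i => e (i + 1) := h.assign fun i => .inl (i + 1)

instance D0.eq {g g' : (ℕ → N.Dom) → N.Dom} [h : Poly g] [h' : Poly g'] :
    D0 fun e => g e = g' e := by
  obtain ⟨t, t', s, h, h'⟩ := h.exists_common h'
  obtain ⟨X⟩ := N.nonempty
  exact ⟨t ≐ t', s, fun _ => X, .eq _ _, fun e => by rw [h, h', Fm.holds_eq]⟩

instance D0.lt {g g' : (ℕ → N.Dom) → N.Dom} [h : Poly g] [h' : Poly g'] :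
    D0 fun e => g e < g' e := by
  obtain ⟨t, t', s, h, h'⟩ := h.exists_common h'
  obtain ⟨X⟩ := N.nonempty
  exact ⟨t ≺ t', s, fun _ => X, .lt _ _, fun e => by rw [h, h', Fm.holds_lt]⟩

instance D0.mem {g : (ℕ → N.Dom) → N.Dom} [h : Poly g] (X : N.Sets) : D0 fun e => g e ∈ X := by
  obtain ⟨t, s, h⟩ := h
  exact ⟨t ε 0, s, fun _ => X, .mem _ _, fun e => by rw [h, Fm.holds_mem]⟩

instance D0.imp {P P' : (ℕ → N.Dom) → Prop} [h : D0 P] [h' : D0 P'] : D0 fun e => P e → P' e := by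
  obtain ⟨θ, θ', s, f, hθ, hθ', h, h'⟩ := h.exists_common h'
  exact ⟨θ ➔ θ', s, f, hθ.imp hθ', fun e => by rw [h, h', Fm.holds_imp]⟩

instance D0.false : D0 fun _ : ℕ → N.Dom => False := by
  obtain ⟨X⟩ := N.nonempty
  exact ⟨.bot, fun _ => .inl 0, fun _ => X, .bot, fun _ => Iff.rfl⟩

instance D0.not {P : (ℕ → N.Dom) → Prop} [D0 P] : D0 fun e => ¬ P e :=
  (inferInstance : D0 fun e => P e → False)

instance D0.and {P P' : (ℕ → N.Dom) → Prop} [D0 P] [D0 P'] : D0 fun e => P e ∧ P' e :=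
  (inferInstance : D0 fun e => ¬ (P e → ¬ P' e)).congr fun e => by tauto

instance D0.or {P P' : (ℕ → N.Dom) → Prop} [D0 P] [D0 P'] : D0 fun e => P e ∨ P' e :=
  (inferInstance : D0 fun e => ¬ P e → P' e).congr fun e => by tauto

instance D0.iff {P P' : (ℕ → N.Dom) → Prop} [D0 P] [D0 P'] : D0 fun e => P e ↔ P' e :=
  (inferInstance : D0 fun e => (P e → P' e) ∧ (P' e → P e)).congr fun e => by tauto

/-- The renaming that moves the variable `0` out of the assignment. -/
theorem assign_scons {α : Type} (s : ℕ → ℕ ⊕ α) : ∃ (s' : ℕ → ℕ ⊕ α) (r : ℕ → ℕ),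
    ∀ x e i, scons x (assign s' e) (r i) = assign s (scons x e) i := by
  refine ⟨fun i => (s i).elim (fun j => .inl (j - 1)) .inr,
    fun i => (s i).elim (fun j => if j = 0 then 0 else i + 1) fun _ => i + 1, fun x e i => ?_⟩
  rcases h : s i with (_ | j) | a <;> simp [assign, h, scons]

instance D0.ball {g : (ℕ → N.Dom) → N.Dom} {P : N.Dom → (ℕ → N.Dom) → Prop} [h : Poly g]
    [h' : D0 fun e => P (e 0) fun i => e (i + 1)] : D0 fun e => ∀ x, x < g e → P x e := by
  obtain ⟨t, s, h⟩ := h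
  obtain ⟨θ, s', f, hθ, h'⟩ := h'
  obtain ⟨s'', r, hr⟩ := assign_scons s'
  -- The bound keeps its parameters at even places. A variable of `θ` is either the bound variable
  -- (`r i = 0`) or a parameter at an odd place, raised by one under the quantifier.
  refine ⟨(♯0 ≺ (t.subst fun i => ♯(2 * i)).up 1 ➔
    θ.subst (fun i => ♯(if r i = 0 then 0 else 2 * (r i - 1) + 1 + 1)) id).all, mix s s'', f,
    .ball _ (hθ.subst _ _), fun e => forall_congr' fun x => ?_⟩
  have h1 : (♯0 ≺ (t.subst fun i => ♯(2 * i)).up 1).Holds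
      (scons x (SOA.assign (mix s s'') e)) f ↔ x < g e := by
    simp only [Fm.holds_lt, Tm.val_up, Tm.val_var, scons_zero, scons_succ]
    rw [h, t.val_mix_even]
  rw [Fm.holds_imp, h1, Fm.holds_subst]
  refine imp_congr_right fun _ => ?_
  rw [show P x e ↔ _ from h' (scons x e)]
  congr! 1
  funext i
  rw [← hr, Tm.val_var]
  rcases hri : r i with _ | j
  · rfl
  · simp [scons, assign_mix_odd]

instance D0.bex {g : (ℕ → N.Dom) → N.Dom} {P : N.Dom → (ℕ → N.Dom) → Prop} [Poly g]
    [D0 fun e => P (e 0) fun i => e (i + 1)] : D0 fun e => ∃ x, x < g e ∧ P x e :=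
  (inferInstance : D0 fun e => ¬ ∀ x, x < g e → ¬ P x e).congr fun e => by
    simp only [not_forall, not_not, exists_prop]

instance D1.ex_of_D0 {P : N.Dom → (ℕ → N.Dom) → Prop} [h : D0 fun e => P (e 0) fun i => e (i + 1)] :
    D1 fun e => ∃ x, P x e :=
  ⟨_, h, fun _ => Iff.rfl⟩

theorem D1.of_D0 {P : (ℕ → N.Dom) → Prop} [h : D0 P] : D1 P :=
  ⟨_, h.tail, fun e => ⟨fun h => ⟨e 0, h⟩, fun ⟨_, h⟩ => h⟩⟩

/-- The axiom schemes want the two arguments at the indices `0` and `1` and the parameters after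
them. Variables other than these two are irrelevant and are set to `0`. -/
theorem D0.exists_formulas {P P' : N.Dom → N.Dom → Prop}
    (h : D0 fun e => P (e 0) (e 1)) (h' : D0 fun e => P' (e 0) (e 1)) :
    ∃ (θ θ' : Fm) (e : ℕ → N.Dom) (f : ℕ → N.Sets), IsBounded θ ∧ IsBounded θ' ∧
      (∀ x y, P x y ↔ θ.Holds (scons x (scons y e)) f) ∧
      ∀ x y, P' x y ↔ θ'.Holds (scons x (scons y e)) f := by
  obtain ⟨θ, θ', s, f, hθ, hθ', h, h'⟩ := h.exists_common h'
  obtain ⟨s', r, hr⟩ := assign_scons s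
  obtain ⟨s'', r', hr'⟩ := assign_scons s'
  let ρ : ℕ → Tm := fun i => ♯(if r i = 0 then 0 else r' (r i - 1) + 1)
  have key : ∀ x y, (fun i => (ρ i).val (scons x (scons y (SOA.assign s'' fun _ => 0)))) =
      SOA.assign s (scons x (scons y fun _ => 0)) := by
    intro x y
    funext i
    rw [← hr]
    simp only [ρ, Tm.val_var]
    rcases hri : r i with _ | j
    · rfl
    · simpa [scons] using hr' y (fun _ => 0) j
  refine ⟨θ.subst ρ id, θ'.subst ρ id, SOA.assign s'' fun _ => 0, f, hθ.subst _ _, hθ'.subst _ _,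
    fun x y => ?_, fun x y => ?_⟩
  · rw [Fm.holds_subst, key]
    exact h (scons x (scons y fun _ => 0))
  · rw [Fm.holds_subst, key]
    exact h' (scons x (scons y fun _ => 0))

/-- A predicate of `e 0` alone may be evaluated at a constant assignment; the matrix of its `Σ⁰₁`
definition then becomes binary, in the witness and the argument. -/
theorem D0.scons_const {Q : (ℕ → N.Dom) → Prop} (h : D0 Q) :
    D0 fun e => Q (scons (e 0) fun _ => e 1) :=
  (h.assign fun i => .inl (min i 1)).congr fun e => by
    rw [show (SOA.assign (fun i => .inl (min i 1)) e) = scons (e 0) fun _ => e 1 from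
      funext fun i => by rcases i with _ | _ | i <;> rfl]

end Definability

/-! ## Models of `RCA0` -/

class Str.IsRCA (N : Str) : Prop where
  models : N.Models RCA0

section Models

variable {N : Str} [hN : N.IsRCA]

/-- `Σ⁰₁` induction. -/
theorem sigma_induction {P : N.Dom → Prop} [h : D1 fun e => P (e 0)] (zero : P 0)
    (succ : ∀ x, P x → P (x + 1)) (x : N.Dom) : P x := by
  obtain ⟨Q, hQ, h⟩ := h
  obtain ⟨θ, -, e, f, hθ, -, hP, -⟩ :=
    D0.exists_formulas (P := fun w x => Q (scons w fun _ => x))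
      (P' := fun w x => Q (scons w fun _ => x)) hQ.scons_const hQ.scons_const
  have key : ∀ x, P x ↔ θ.ex.Holds (scons x e) f := fun x => by
    rw [Fm.holds_ex, show P x ↔ _ from h fun _ => x]
    exact exists_congr fun w => hP w x
  have := hN.models _ (.induction θ.ex ⟨θ, hθ, rfl⟩) e f
  simp only [Fm.holds_imp, Fm.holds_all, Fm.inst, Fm.holds_subst] at this
  refine (key x).2 (this ?_ ?_ x)
  · convert (key 0).1 zero using 1
    · funext i
      cases i <;> rfl
    · rfl
  · intro y hy
    convert (key (y + 1)).1 (succ y ((key y).2 hy)) using 1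
    · funext i
      cases i <;> rfl
    · rfl

/-- `Δ⁰₁` comprehension. -/
theorem delta_comprehension {P : N.Dom → Prop} [h : D1 fun e => P (e 0)]
    [h' : D1 fun e => ¬ P (e 0)] : ∃ X : N.Sets, ∀ x, x ∈ X ↔ P x := by
  obtain ⟨Q, hQ, h⟩ := h
  obtain ⟨Q', hQ', h'⟩ := h'
  -- Negating the matrix of the `Σ⁰₁` definition of the complement gives the `Π⁰₁` definition of
  -- `P`.
  obtain ⟨θ, θ', e, f, hθ, hθ', hP, hP'⟩ :=
    D0.exists_formulas (P := fun w x => Q (scons w fun _ => x))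
      (P' := fun w x => ¬ Q' (scons w fun _ => x))
      hQ.scons_const (haveI := hQ'.scons_const; inferInstance)
  have key : ∀ x, P x ↔ θ.ex.Holds (scons x e) f := fun x => by
    rw [Fm.holds_ex, show P x ↔ _ from h fun _ => x]
    exact exists_congr fun w => hP w x
  have key' : ∀ x, P x ↔ θ'.all.Holds (scons x e) f := fun x => by
    rw [Fm.holds_all, ← not_not (a := P x), show ¬ P x ↔ _ from h' fun _ => x, not_exists]
    exact forall_congr' fun w => hP' w x
  have := hN.models _ (.comprehension θ.ex θ'.all ⟨θ, hθ, rfl⟩ ⟨θ', hθ', rfl⟩) e f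
  simp only [Fm.holds_imp, Fm.holds_all, Fm.holds_iff, Fm.holds_exS, Fm.wkS, Fm.holds_subst,
    Fm.holds_mem, Tm.val_var, scons_zero, scons_succ] at this
  obtain ⟨X, hX⟩ := this fun x => by rw [← key, ← Fm.holds_all, ← key']
  exact ⟨X, fun x => (hX x).trans (key x).symm⟩

end Models

namespace Str

variable {N : Str} [hN : N.IsRCA]

/-! ## Arithmetic in a model -/

theorem exists_holds {φ : Fm} (h : φ ∈ RCA0) (e : ℕ → N.Dom) : ∃ f : ℕ → N.Sets, φ.Holds e f :=
  N.nonempty.elim fun X => ⟨fun _ => X, hN.models φ h e _⟩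

theorem succ_ne_zero (x : N.Dom) : x + 1 ≠ 0 :=
  (exists_holds .succ_ne_zero fun _ => x).elim fun _ h => h

theorem succ_inj {x y : N.Dom} (h : x + 1 = y + 1) : x = y :=
  (exists_holds .succ_inj (scons x fun _ => y)).elim fun _ h' => h' h

theorem add_zero (x : N.Dom) : x + 0 = x :=
  (exists_holds .add_zero fun _ => x).elim fun _ h => h

theorem add_succ (x y : N.Dom) : x + (y + 1) = (x + y) + 1 :=
  (exists_holds .add_succ (scons x fun _ => y)).elim fun _ h => h

theorem mul_zero (x : N.Dom) : x * 0 = 0 :=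
  (exists_holds .mul_zero fun _ => x).elim fun _ h => h

theorem mul_succ (x y : N.Dom) : x * (y + 1) = x * y + x :=
  (exists_holds .mul_succ (scons x fun _ => y)).elim fun _ h => h

theorem not_lt_zero (x : N.Dom) : ¬ x < 0 :=
  (exists_holds .not_lt_zero fun _ => x).elim fun _ h => h

theorem lt_succ {x y : N.Dom} : x < y + 1 ↔ x < y ∨ x = y :=
  (exists_holds .lt_succ (scons x fun _ => y)).elim fun f h => by
    simpa only [Fm.holds_iff, Fm.holds_or] using! h

/-- Induction for bounded formulas. -/
theorem delta_induction {P : N.Dom → Prop} [D0 fun e => P (e 0)] (zero : P 0)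
    (succ : ∀ x, P x → P (x + 1)) (x : N.Dom) : P x :=
  haveI : D1 fun e => P (e 0) := D1.of_D0
  sigma_induction zero succ x

theorem zero_add (x : N.Dom) : 0 + x = x :=
  delta_induction (P := fun x => 0 + x = x) (add_zero 0) (fun x h => by rw [add_succ, h]) x

theorem succ_add (x y : N.Dom) : (x + 1) + y = (x + y) + 1 :=
  delta_induction (P := fun y => (x + 1) + y = (x + y) + 1) (by rw [add_zero, add_zero])
    (fun y h => by rw [add_succ, h, add_succ]) y

theorem add_comm (x y : N.Dom) : x + y = y + x :=
  delta_induction (P := fun y => x + y = y + x) (by rw [add_zero, zero_add])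
    (fun y h => by rw [add_succ, h, succ_add]) y

theorem add_assoc (x y z : N.Dom) : x + y + z = x + (y + z) :=
  delta_induction (P := fun z => x + y + z = x + (y + z)) (by rw [add_zero, add_zero])
    (fun z h => by rw [add_succ, h, add_succ, add_succ]) z

theorem zero_mul (x : N.Dom) : 0 * x = 0 :=
  delta_induction (P := fun x => 0 * x = 0) (mul_zero 0)
    (fun x h => by rw [mul_succ, h, add_zero]) x

theorem succ_mul (x y : N.Dom) : (x + 1) * y = x * y + y :=
  delta_induction (P := fun y => (x + 1) * y = x * y + y) (by rw [mul_zero, mul_zero, add_zero])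
    (fun y h => by
      rw [mul_succ, h, mul_succ, ← add_assoc, ← add_assoc, add_assoc (x * y) y x, add_comm y x,
        ← add_assoc]) y

theorem mul_comm (x y : N.Dom) : x * y = y * x :=
  delta_induction (P := fun y => x * y = y * x) (by rw [mul_zero, zero_mul])
    (fun y h => by rw [mul_succ, h, succ_mul]) y

theorem mul_add (x y z : N.Dom) : x * (y + z) = x * y + x * z :=
  delta_induction (P := fun z => x * (y + z) = x * y + x * z)
    (by rw [mul_zero, add_zero, add_zero])
    (fun z h => by rw [add_succ, mul_succ, h, mul_succ, add_assoc]) z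

theorem mul_assoc (x y z : N.Dom) : x * y * z = x * (y * z) :=
  delta_induction (P := fun z => x * y * z = x * (y * z)) (by simp only [mul_zero])
    (fun z h => by rw [mul_succ, h, mul_succ, mul_add]) z

theorem mul_one (x : N.Dom) : x * 1 = x := by
  have := mul_succ x 0
  rwa [zero_add, mul_zero, zero_add] at this

theorem add_right_cancel (x y z : N.Dom) : x + z = y + z → x = y :=
  delta_induction (P := fun z => x + z = y + z → x = y) (by simp only [add_zero, imp_self])
    (fun z h h' => h (succ_inj (by rwa [add_succ, add_succ] at h'))) z

/-- This instance makes `ring` usable inside the model; the order instances below do the same for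
general lemmas on ordered semirings. -/
instance : CommSemiring N.Dom where
  add_assoc := add_assoc
  zero_add := zero_add
  add_zero := add_zero
  add_comm := add_comm
  left_distrib := mul_add
  right_distrib x y z := by rw [mul_comm, mul_add, mul_comm z x, mul_comm z y]
  zero_mul := zero_mul
  mul_zero := mul_zero
  mul_assoc := mul_assoc
  one_mul x := by rw [mul_comm, mul_one]
  mul_one := mul_one
  mul_comm := mul_comm
  nsmul := nsmulRec

theorem zero_lt_succ (x : N.Dom) : 0 < x + 1 :=
  delta_induction (P := fun x => 0 < x + 1) (lt_succ.2 (.inr rfl))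
    (fun _ h => lt_succ.2 (.inl h)) x

theorem eq_zero_or_succ (x : N.Dom) : x = 0 ∨ ∃ y, x = y + 1 := by
  -- The case distinction is moved under the quantifier, so that the induction formula is literally
  -- an existential quantifier before a bounded matrix.
  have : ∃ y, x ≠ 0 → x = y + 1 :=
    sigma_induction (P := fun x => ∃ y, x ≠ 0 → x = y + 1) ⟨0, by simp⟩
      (fun x _ => ⟨x, fun _ => rfl⟩) x
  obtain ⟨y, hy⟩ := this
  by_cases h : x = 0
  · exact .inl h
  · exact .inr ⟨y, hy h⟩

theorem lt_add_succ (x z : N.Dom) : x < x + z + 1 :=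
  delta_induction (P := fun z => x < x + z + 1) (lt_succ.2 (.inr (by simp)))
    (fun z h => lt_succ.2 (.inl (by rwa [← add_assoc]))) z

theorem lt_iff_exists {x y : N.Dom} : x < y ↔ ∃ z, y = x + z + 1 := by
  constructor
  · intro h
    have : ∃ z, x < y → y = x + z + 1 := by
      refine sigma_induction (P := fun y => ∃ z, x < y → y = x + z + 1)
        ⟨0, fun h => (not_lt_zero _ h).elim⟩ ?_ y
      rintro y ⟨z, hz⟩
      by_cases h : x < y
      · exact ⟨z + 1, fun _ => by rw [hz h]; ring⟩
      · refine ⟨0, fun h' => ?_⟩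
        rcases lt_succ.1 h' with h' | rfl
        · exact (h h').elim
        · simp
    exact this.imp fun z hz => hz h
  · rintro ⟨z, rfl⟩
    exact lt_add_succ x z

theorem trichotomy (x y : N.Dom) : x < y ∨ x = y ∨ y < x := by
  refine delta_induction (P := fun y => x < y ∨ x = y ∨ y < x) ?_ ?_ y
  · rcases eq_zero_or_succ x with rfl | ⟨z, rfl⟩
    · simp
    · exact .inr (.inr (zero_lt_succ z))
  · rintro y (h | rfl | h)
    · exact .inl (lt_succ.2 (.inl h))
    · exact .inl (lt_succ.2 (.inr rfl))
    · obtain ⟨z, rfl⟩ := lt_iff_exists.1 h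
      rcases eq_zero_or_succ z with rfl | ⟨w, rfl⟩
      · simp
      · exact .inr (.inr (lt_iff_exists.2 ⟨w, by ring⟩))

theorem lt_irrefl (x : N.Dom) : ¬ x < x := by
  intro h
  obtain ⟨z, hz⟩ := lt_iff_exists.1 h
  refine succ_ne_zero z (add_right_cancel _ _ x ?_)
  rw [zero_add]
  conv_rhs => rw [hz]
  ring

theorem lt_trans {x y z : N.Dom} (h : x < y) (h' : y < z) : x < z := by
  obtain ⟨a, rfl⟩ := lt_iff_exists.1 h
  obtain ⟨b, rfl⟩ := lt_iff_exists.1 h'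
  exact lt_iff_exists.2 ⟨a + b + 1, by ring⟩

noncomputable instance : LinearOrder N.Dom where
  le x y := x < y ∨ x = y
  lt := (· < ·)
  le_refl x := .inr rfl
  le_trans := by
    rintro x y z (h | rfl) (h' | rfl)
    · exact .inl (lt_trans h h')
    · exact .inl h
    · exact .inl h'
    · exact .inr rfl
  lt_iff_le_not_ge x y := by
    constructor
    · intro h
      refine ⟨.inl h, ?_⟩
      rintro (h' | rfl)
      · exact lt_irrefl _ (lt_trans h h')
      · exact lt_irrefl _ h
    · rintro ⟨h | rfl, h'⟩
      · exact h
      · exact (h' (.inr rfl)).elim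
  le_antisymm := by
    rintro x y (h | rfl) (h' | h')
    · exact (lt_irrefl _ (lt_trans h h')).elim
    · exact h'.symm
    · rfl
    · rfl
  le_total x y := by
    rcases trichotomy x y with h | h | h
    · exact .inl (.inl h)
    · exact .inl (.inr h)
    · exact .inr (.inl h)
  toDecidableLE := Classical.decRel _

theorem le_iff_exists {x y : N.Dom} : x ≤ y ↔ ∃ z, y = x + z := by
  constructor
  · rintro (h | rfl)
    · obtain ⟨z, rfl⟩ := lt_iff_exists.1 h
      exact ⟨z + 1, by ring⟩
    · exact ⟨0, by simp⟩
  · rintro ⟨z, rfl⟩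
    rcases eq_zero_or_succ z with rfl | ⟨w, rfl⟩
    · exact .inr (by simp)
    · exact .inl (lt_iff_exists.2 ⟨w, by ring⟩)

instance : IsStrictOrderedRing N.Dom where
  add_le_add_left x y h z := by
    obtain ⟨w, rfl⟩ := le_iff_exists.1 h
    exact le_iff_exists.2 ⟨w, by ring⟩
  le_of_add_le_add_left x y z h := by
    obtain ⟨w, hw⟩ := le_iff_exists.1 h
    exact le_iff_exists.2 ⟨w, add_right_cancel _ _ x (by rw [add_comm z x, hw]; ring)⟩
  zero_le_one := le_iff_exists.2 ⟨1, by simp⟩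
  exists_pair_ne := ⟨0, 1, fun h => succ_ne_zero (0 : N.Dom) (by rw [zero_add, ← h])⟩
  mul_lt_mul_of_pos_left x hx y z h := by
    obtain ⟨a, rfl⟩ := lt_iff_exists.1 hx
    obtain ⟨b, rfl⟩ := lt_iff_exists.1 h
    exact lt_iff_exists.2 ⟨a * b + b + a, by ring⟩
  mul_lt_mul_of_pos_right x hx y z h := by
    obtain ⟨a, rfl⟩ := lt_iff_exists.1 hx
    obtain ⟨b, rfl⟩ := lt_iff_exists.1 h
    exact lt_iff_exists.2 ⟨a * b + b + a, by ring⟩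

instance : CanonicallyOrderedAdd N.Dom where
  exists_add_of_le h := le_iff_exists.1 h
  le_add_self _ y := le_iff_exists.2 ⟨y, add_comm _ _⟩
  le_self_add _ y := le_iff_exists.2 ⟨y, rfl⟩

theorem lt_succ_iff {x y : N.Dom} : x < y + 1 ↔ x ≤ y := lt_succ

noncomputable instance : SuccOrder N.Dom := SuccOrder.ofSuccLeIff (· + 1) fun {a b} => by
  rw [← lt_succ_iff, add_lt_add_iff_right]

noncomputable instance : SuccAddOrder N.Dom := ⟨fun _ => rfl⟩

end Str

section Closure

variable {N : Str} [hN : N.IsRCA]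

/-! ## Closure properties of definable predicates -/

instance D0.le {g g' : (ℕ → N.Dom) → N.Dom} [Poly g] [Poly g'] : D0 fun e => g e ≤ g' e :=
  (inferInstance : D0 fun e => g e < g' e ∨ g e = g' e).congr fun _ => le_iff_lt_or_eq

/-- Substitution of terms is simulated by bounded quantifiers over numbers that equal their values.
-/
theorem D0.comp₂ {R : N.Dom → N.Dom → Prop} (h : D0 fun e => R (e 0) (e 1))
    (g g' : (ℕ → N.Dom) → N.Dom) [Poly g] [Poly g'] : D0 fun e => R (g e) (g' e) :=
  haveI : Poly fun e => g fun i => e (i + 1) := Poly.tail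
  haveI : Poly fun e => g' fun i => e (i + 1) := Poly.tail
  haveI : Poly fun e => g fun i => e (i + 1 + 1) :=
    Poly.tail (g := fun e => g fun i => e (i + 1))
  (inferInstance : D0 fun e => ∃ y, y < g' e + 1 ∧ y = g' e ∧ ∃ x, x < g e + 1 ∧ x = g e ∧
    R x y).congr fun _ =>
    ⟨fun h => ⟨_, lt_add_one _, rfl, _, lt_add_one _, rfl, h⟩,
      fun ⟨_, _, hy, _, _, hx, h⟩ => hx ▸ hy ▸ h⟩

attribute [instance] D1.of_D0

/-- Two unbounded quantifiers are contracted by guessing a common strict bound `z` for both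
witnesses, which avoids pairing. -/
instance D1.ex {P : N.Dom → (ℕ → N.Dom) → Prop} [h : D1 fun e => P (e 0) fun i => e (i + 1)] :
    D1 fun e => ∃ x, P x e := by
  obtain ⟨Q, hQ, h⟩ := h
  have : D0 fun e => Q (scons (e 0) (scons (e 1) fun i => e (i + 3))) := by
    refine (hQ.assign fun i => .inl (if i < 2 then i else i + 1)).congr fun e => ?_
    congr! 1
    funext i
    rcases i with _ | _ | i <;> rfl
  refine (inferInstance : D1 fun e => ∃ z, ∃ x, x < z ∧ ∃ w, w < z ∧
    Q (scons w (scons x e))).congr fun e => ?_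
  constructor
  · rintro ⟨x, hx⟩
    obtain ⟨w, hw⟩ := (h (scons x e)).1 hx
    exact ⟨max x w + 1, x, by simp, w, by simp, hw⟩
  · rintro ⟨_, x, -, w, -, hw⟩
    exact ⟨x, (h (scons x e)).2 ⟨w, hw⟩⟩

instance D1.and {P P' : (ℕ → N.Dom) → Prop} [h : D1 P] [h' : D1 P'] : D1 fun e => P e ∧ P' e := by
  obtain ⟨Q, hQ, h⟩ := h
  obtain ⟨Q', hQ', h'⟩ := h'
  have h1 : D0 fun e => Q (scons (e 1) fun i => e (i + 2)) := by
    refine (hQ.assign fun i => .inl (i + 1)).congr fun e => ?_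
    congr! 1
    funext i
    rcases i with _ | i <;> rfl
  have h2 : D0 fun e => Q' (scons (e 0) fun i => e (i + 2)) := by
    refine (hQ'.assign fun i => .inl (if i = 0 then 0 else i + 1)).congr fun e => ?_
    congr! 1
    funext i
    rcases i with _ | i <;> rfl
  refine (inferInstance : D1 fun e => ∃ x, ∃ y, Q (scons x e) ∧ Q' (scons y e)).congr fun e => ?_
  rw [h, h']
  exact ⟨fun ⟨⟨x, hx⟩, y, hy⟩ => ⟨x, y, hx, hy⟩, fun ⟨x, y, hx, hy⟩ => ⟨⟨x, hx⟩, y, hy⟩⟩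

instance D1.or {P P' : (ℕ → N.Dom) → Prop} [h : D1 P] [h' : D1 P'] : D1 fun e => P e ∨ P' e := by
  obtain ⟨Q, hQ, h⟩ := h
  obtain ⟨Q', hQ', h'⟩ := h'
  refine ⟨fun e => Q e ∨ Q' e, inferInstance, fun e => ?_⟩
  rw [h, h', exists_or]

instance D1.imp {P P' : (ℕ → N.Dom) → Prop} [D0 P] [D1 P'] : D1 fun e => P e → P' e :=
  (inferInstance : D1 fun e => ¬ P e ∨ P' e).congr fun e => by tauto

/-- `Σ⁰₁` collection for a bounded matrix. -/
theorem collection {R : N.Dom → N.Dom → Prop} [D0 fun e => R (e 0) (e 1)] (b : N.Dom)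
    (h : ∀ x, x < b → ∃ w, R w x) : ∃ B, ∀ x, x < b → ∃ w, w < B ∧ R w x := by
  -- The hypothesis is doubled because the induction replaces its first copy by `x < j`, while the
  -- second keeps `x` where witnesses are known to exist.
  have : ∃ B, ∀ x, x < b → x < b → ∃ w, w < B ∧ R w x := by
    refine sigma_induction (P := fun j => ∃ B, ∀ x, x < j → x < b → ∃ w, w < B ∧ R w x)
      ⟨0, fun x hx => (not_lt_zero hx).elim⟩ ?_ b
    rintro j ⟨B, hB⟩
    by_cases hj : j < b
    · obtain ⟨w, hw⟩ := h j hj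
      refine ⟨max B (w + 1), fun x hx hxb => ?_⟩
      rcases (Str.lt_succ_iff.1 hx).lt_or_eq with hx | rfl
      · obtain ⟨v, hv, hR⟩ := hB x hx hxb
        exact ⟨v, lt_max_of_lt_left hv, hR⟩
      · exact ⟨w, lt_max_of_lt_right (lt_add_one w), hw⟩
    · refine ⟨B, fun x hx hxb => hB x ?_ hxb⟩
      exact hxb.trans_le (not_lt.1 hj)
  obtain ⟨B, hB⟩ := this
  exact ⟨B, fun x hx => hB x hx hx⟩

/-- Collection bounds all witnesses at once, so the unbounded quantifier moves in front of the
bounded one. -/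
instance D1.ball {g : (ℕ → N.Dom) → N.Dom} {P : N.Dom → (ℕ → N.Dom) → Prop} [Poly g]
    [h : D1 fun e => P (e 0) fun i => e (i + 1)] : D1 fun e => ∀ x, x < g e → P x e := by
  obtain ⟨Q, hQ, h⟩ := h
  have : D0 fun e => Q (scons (e 0) (scons (e 1) fun i => e (i + 3))) := by
    refine (hQ.assign fun i => .inl (if i < 2 then i else i + 1)).congr fun e => ?_
    congr! 1
    funext i
    rcases i with _ | _ | i <;> rfl
  have : Poly fun e => g fun i => e (i + 1) := Poly.tail
  refine (inferInstance : D1 fun e => ∃ B, ∀ x, x < g e → ∃ w, w < B ∧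
    Q (scons w (scons x e))).congr fun e => ?_
  have h' : ∀ x, P x e ↔ ∃ w, Q (scons w (scons x e)) := fun x => h (scons x e)
  simp only [h']
  constructor
  · intro hx
    have : D0 fun e' => Q (scons (e' 0) (scons (e' 1) e)) := by
      refine (hQ.assign (scons (.inl 0) (scons (.inl 1) fun i => .inr (e i)))).congr fun e => ?_
      congr! 1
      funext i
      rcases i with _ | _ | i <;> rfl
    exact collection _ hx
  · rintro ⟨B, hB⟩ x hx
    obtain ⟨w, -, hw⟩ := hB x hx
    exact ⟨w, hw⟩

/-- The `Σ⁰₁` maximum principle. -/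
theorem exists_last {P : N.Dom → Prop} [D1 fun e => P (e 0)] (h0 : P 0) {b : N.Dom}
    (hb : ∀ x, P x → x ≤ b) : ∃ x, P x ∧ ¬ P (x + 1) := by
  by_contra! h
  exact absurd (hb _ (sigma_induction h0 h (b + 1))) (not_le.2 (lt_add_one b))

/-- The least number principle for bounded formulas. -/
theorem exists_least {P : N.Dom → Prop} [D0 fun e => P (e 0)] {a : N.Dom} (ha : P a) :
    ∃ x, P x ∧ ∀ y, y < x → ¬ P y := by
  by_contra! h
  have : ∀ y, y < a + 1 → ¬ P y := by
    refine Str.delta_induction (P := fun x => ∀ y, y < x → ¬ P y)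
      (fun y hy => (not_lt_zero hy).elim) ?_ (a + 1)
    intro x hx y hy hP
    rcases (Str.lt_succ_iff.1 hy).lt_or_eq with hy | rfl
    · exact hx y hy hP
    · obtain ⟨z, hz, hPz⟩ := h y hP
      exact hx z hz hPz
  exact this a (lt_add_one a) ha

end Closure

section Coding

variable {N : Str} [hN : N.IsRCA]

/-! ## Divisibility and pairs -/

instance D0.dvd {g g' : (ℕ → N.Dom) → N.Dom} [Poly g] [Poly g'] : D0 fun e => g e ∣ g' e := by
  refine D0.comp₂ (R := fun x y => x ∣ y) ?_ g g'
  refine (inferInstance : D0 fun e : ℕ → N.Dom => ∃ q, q < e 1 + 1 ∧ e 1 = e 0 * q).congr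
    fun e => ⟨?_, fun ⟨q, _, hq⟩ => ⟨q, hq⟩⟩
  rintro ⟨q, hq⟩
  -- For divisor `0` the quotient is not bounded by the product, but then `0` is a quotient as well.
  rcases eq_or_ne (e 0) 0 with h | h
  · exact ⟨0, by simp, by simp [hq, h]⟩
  · refine ⟨q, Str.lt_succ_iff.2 ?_, hq⟩
    rw [hq]
    exact le_mul_of_one_le_left zero_le (Order.one_le_iff_pos.2 (pos_iff_ne_zero.2 h))

/-- There is no subtraction, so the quotients `p` of `x` and `q` of `x + y` are compared: either `y`
is `a` times their difference, or `y = 0`. -/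
theorem dvd_of_dvd_add {a x y : N.Dom} (h : a ∣ x + y) (hx : a ∣ x) : a ∣ y := by
  obtain ⟨p, rfl⟩ := hx
  obtain ⟨q, hq⟩ := h
  rcases le_total p q with hpq | hpq
  · obtain ⟨r, rfl⟩ := exists_add_of_le hpq
    rw [mul_add] at hq
    exact ⟨r, add_left_cancel hq⟩
  · have : a * p + y ≤ a * p + 0 := by
      rw [hq, add_zero]
      exact mul_le_mul_right hpq a
    rw [nonpos_iff_eq_zero.1 (le_of_add_le_add_left this)]
    exact dvd_zero a

/-- The code of an ordered pair. -/
def pr (x y : N.Dom) : N.Dom := (x + y) * (x + y) + x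

instance Poly.pr {g g' : (ℕ → N.Dom) → N.Dom} [Poly g] [Poly g'] : Poly fun e => pr (g e) (g' e) :=
  (inferInstance : Poly fun e => (g e + g' e) * (g e + g' e) + g e)

theorem le_mul_self (x : N.Dom) : x ≤ x * x := by
  rcases Str.eq_zero_or_succ x with rfl | ⟨y, rfl⟩
  · simp
  · exact le_mul_of_one_le_left zero_le (by simp)

theorem left_le_pr (x y : N.Dom) : x ≤ pr x y := le_add_self

theorem right_le_pr (x y : N.Dom) : y ≤ pr x y :=
  le_add_self.trans ((le_mul_self _).trans le_self_add)

/-- The code of a pair with sum `s` lies between `s²` and `s² + s`, below `(s + 1)²`; so the code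
determines the sum. -/
theorem sum_le_of_pr_eq {x y x' y' : N.Dom} (h : pr x y = pr x' y') : x + y ≤ x' + y' := by
  by_contra! hlt
  obtain ⟨z, hz⟩ := Str.lt_iff_exists.1 hlt
  have h1 : x ≤ x + y := le_self_add
  have h2 : x' ≤ x' + y' := le_self_add
  have h3 : pr x' y' < pr x y := by
    unfold pr
    rw [hz]
    calc (x' + y') * (x' + y') + x' ≤ (x' + y') * (x' + y') + (x' + y') := by gcongr
      _ < (x' + y') * (x' + y') + (x' + y') + (2 * (x' + y') * z + (x' + y') + z * z + 2 * z + x) + 1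
        := (le_self_add).trans_lt (lt_add_one _)
      _ = _ := by ring
  exact h3.ne' h

theorem pr_inj {x y x' y' : N.Dom} : pr x y = pr x' y' ↔ x = x' ∧ y = y' := by
  refine ⟨fun h => ?_, fun h => by rw [h.1, h.2]⟩
  have hs : x + y = x' + y' := le_antisymm (sum_le_of_pr_eq h) (sum_le_of_pr_eq h.symm)
  have hx : x = x' := by
    rw [pr, pr, hs] at h
    exact add_left_cancel h
  subst hx
  exact ⟨rfl, add_left_cancel hs⟩

/-! ## Coding of finite sets -/

/-- `t` is an element of the finite set coded by `c`. -/
def Elt (t c : N.Dom) : Prop := ∃ k m n, c = pr k (pr m n) ∧ t < k ∧ ∃ q, (m * (t + 1) + 1) * q = n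

theorem elt_pr {t k m n : N.Dom} : Elt t (pr k (pr m n)) ↔ t < k ∧ m * (t + 1) + 1 ∣ n := by
  constructor
  · rintro ⟨k', m', n', h, ht, q, hq⟩
    simp only [pr_inj] at h
    obtain ⟨rfl, rfl, rfl⟩ := h
    exact ⟨ht, q, hq.symm⟩
  · rintro ⟨ht, q, hq⟩
    exact ⟨k, m, n, rfl, ht, q, hq.symm⟩

theorem Elt.lt {t c : N.Dom} (h : Elt t c) : t < c := by
  obtain ⟨k, m, n, rfl, ht, -⟩ := h
  exact ht.trans_le (left_le_pr _ _)

instance D0.elt {g g' : (ℕ → N.Dom) → N.Dom} [Poly g] [Poly g'] : D0 fun e => Elt (g e) (g' e) := by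
  refine D0.comp₂ (R := fun x y => Elt x y) ?_ g g'
  refine (inferInstance : D0 fun e : ℕ → N.Dom => ∃ k, k < e 1 + 1 ∧ ∃ m, m < e 1 + 1 ∧
    ∃ n, n < e 1 + 1 ∧ e 1 = pr k (pr m n) ∧ e 0 < k ∧ m * (e 0 + 1) + 1 ∣ n).congr fun e => ?_
  constructor
  · rintro ⟨k, m, n, hc, ht, q, hq⟩
    refine ⟨k, ?_, m, ?_, n, ?_, hc, ht, q, hq.symm⟩ <;> rw [Str.lt_succ_iff, hc]
    · exact left_le_pr _ _
    · exact (left_le_pr _ _).trans (right_le_pr _ _)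
    · exact (right_le_pr _ _).trans (right_le_pr _ _)
  · rintro ⟨k, -, m, -, n, -, hc, ht, q, hq⟩
    exact ⟨k, m, n, hc, ht, q, hq.symm⟩

/-- A substitute for the factorial of `b`. -/
theorem exists_common_multiple (b : N.Dom) : ∃ m, m ≠ 0 ∧ ∀ i, i < b → i + 1 ∣ m := by
  refine sigma_induction (P := fun b : N.Dom => ∃ m, m ≠ 0 ∧ ∀ i, i < b → i + 1 ∣ m)
    ⟨1, one_ne_zero, fun i hi => (not_lt_zero hi).elim⟩ ?_ b
  rintro b ⟨m, hm, h⟩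
  refine ⟨m * (b + 1), mul_ne_zero hm (Str.succ_ne_zero b), fun i hi => ?_⟩
  rcases (Str.lt_succ_iff.1 hi).lt_or_eq with hi | rfl
  · exact (h i hi).mul_right _
  · exact dvd_mul_left _ _

/-- The moduli `m (t + 1) + 1` are pairwise coprime. -/
theorem dvd_of_dvd_mul_modulus {b m n t t' : N.Dom} (hm : ∀ i, i < b → i + 1 ∣ m) (ht : t < b)
    (ht' : t' < b) (hne : t ≠ t') (h : m * (t + 1) + 1 ∣ n * (m * (t' + 1) + 1)) :
    m * (t + 1) + 1 ∣ n := by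
  -- Here `d + 1` is the distance between `t` and `t'`: the two moduli differ by `m (d + 1)`.
  have key : ∃ d, d < b ∧ m * (t + 1) + 1 ∣ n * (m * (d + 1)) := by
    rcases hne.lt_or_gt with hlt | hlt
    · obtain ⟨d, rfl⟩ := Str.lt_iff_exists.1 hlt
      refine ⟨d, lt_of_le_of_lt ?_ ht', ?_⟩
      · exact le_add_self.trans le_self_add
      · refine dvd_of_dvd_add (x := n * (m * (t + 1) + 1)) ?_ (dvd_mul_left _ _)
        convert h using 1
        ring
    · obtain ⟨d, rfl⟩ := Str.lt_iff_exists.1 hlt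
      refine ⟨d, lt_of_le_of_lt ?_ ht, ?_⟩
      · exact le_add_self.trans le_self_add
      · refine dvd_of_dvd_add ?_ h
        refine Dvd.intro_left n ?_
        ring
  obtain ⟨d, hd, hdvd⟩ := key
  obtain ⟨m', hm'⟩ := hm d hd
  -- As `d + 1` divides `m`, the modulus divides `n (m (t + 1))²`. Modulo it, `m (t + 1)` is `-1`,
  -- so both factors can be removed, one after the other.
  have h1 : m * (t + 1) + 1 ∣ n * ((m * (t + 1)) * (m * (t + 1))) := by
    have : n * ((m * (t + 1)) * (m * (t + 1))) = n * (m * (d + 1)) * (m' * (t + 1) * (t + 1)) := by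
      conv_lhs => rw [mul_mul_mul_comm]; rw [hm']
      conv_rhs => rw [hm']
      ring
    rw [this]
    exact hdvd.mul_right _
  have h2 : m * (t + 1) + 1 ∣ n * (m * (t + 1)) :=
    dvd_of_dvd_add (Dvd.intro (n * (m * (t + 1))) (by ring)) h1
  exact dvd_of_dvd_add (Dvd.intro n (by ring)) h2

/-- This makes `n = 1` a code of the empty set, the starting point of the maximization in
`exists_code`. -/
theorem modulus_ne_one {m t : N.Dom} (hm : m ≠ 0) : ¬ m * (t + 1) + 1 ∣ 1 := by
  rintro ⟨q, hq⟩
  have h1 : q ≠ 0 := by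
    rintro rfl
    simp at hq
  obtain ⟨q, rfl⟩ := (Str.eq_zero_or_succ q).resolve_left h1
  have h2 : 0 < m * (t + 1) := mul_pos (pos_iff_ne_zero.2 hm) (by simp)
  have h3 : (1 : N.Dom) < (m * (t + 1) + 1) * (q + 1) := by
    calc (1 : N.Dom) < m * (t + 1) + 1 := by simpa using h2
      _ ≤ _ := le_mul_of_one_le_right zero_le (by simp)
  exact h3.ne hq

theorem exists_multiple_of_moduli (b m : N.Dom) :
    ∃ n, n ≠ 0 ∧ ∀ t, t < b → m * (t + 1) + 1 ∣ n := by
  refine sigma_induction (P := fun b : N.Dom => ∃ n, n ≠ 0 ∧ ∀ t, t < b → m * (t + 1) + 1 ∣ n)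
    ⟨1, one_ne_zero, fun i hi => (not_lt_zero hi).elim⟩ ?_ b
  rintro b ⟨n, hn, h⟩
  refine ⟨n * (m * (b + 1) + 1), mul_ne_zero hn (Str.succ_ne_zero _), fun i hi => ?_⟩
  rcases (Str.lt_succ_iff.1 hi).lt_or_eq with hi | rfl
  · exact (h i hi).mul_right _
  · exact dvd_mul_left _ _

/-- Each bounded `Σ⁰₁` class has a code. -/
theorem exists_code (F : N.Dom → Prop) [hF : D1 fun e => F (e 0)] (b : N.Dom) :
    ∃ c, ∀ t, Elt t c ↔ t < b ∧ F t := by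
  obtain ⟨m, hm, hdiv⟩ := exists_common_multiple b
  obtain ⟨M, hM, hMdvd⟩ := exists_multiple_of_moduli b m
  -- Among the factorizations `n k = M` in which only moduli of elements of `F` divide `n` and every
  -- modulus divides `n` or `k`, one with essentially largest `n` is taken. The condition is `Σ⁰₁`
  -- because `F` occurs positively.
  obtain ⟨j, ⟨n, k, hnk, hjn, hn⟩, hj⟩ := exists_last (b := M)
    (P := fun j => ∃ n, ∃ k, n * k = M ∧ j ≤ n ∧ ∀ t, t < b →
      (¬ m * (t + 1) + 1 ∣ n ∨ F t) ∧ (m * (t + 1) + 1 ∣ n ∨ m * (t + 1) + 1 ∣ k))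
    ⟨1, M, one_mul M, zero_le, fun t ht => ⟨.inl (modulus_ne_one hm), .inr (hMdvd t ht)⟩⟩ (by
      rintro j ⟨n, k, rfl, hjn, -⟩
      refine hjn.trans (le_mul_of_one_le_right zero_le ?_)
      exact Order.one_le_iff_pos.2 (pos_iff_ne_zero.2 (right_ne_zero_of_mul hM)))
  refine ⟨pr b (pr m n), fun t => ?_⟩
  rw [elt_pr]
  refine and_congr_right fun ht => ⟨fun h => (hn t ht).1.resolve_left (not_not.2 h), fun hFt => ?_⟩
  -- Otherwise the modulus of `t` can be moved from `k` to `n`. By coprimality this disturbs no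
  -- other modulus, and it pushes `n` beyond the maximum `j`.
  by_contra hdvd
  obtain ⟨k', hk'⟩ := (hn t ht).2.resolve_left hdvd
  refine hj ⟨n * (m * (t + 1) + 1), k', by rw [← hnk, hk', mul_assoc], ?_, fun t' ht' => ?_⟩
  · refine Order.add_one_le_of_lt (hjn.trans_lt ?_)
    have hn0 : 0 < n := pos_iff_ne_zero.2 (left_ne_zero_of_mul (hnk ▸ hM))
    refine lt_mul_of_one_lt_right hn0 ?_
    simpa using pos_iff_ne_zero.2 hm
  · rcases eq_or_ne t' t with rfl | hne
    · exact ⟨.inr hFt, .inl (dvd_mul_left _ _)⟩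
    · obtain ⟨h1, h2⟩ := hn t' ht'
      refine ⟨h1.imp_left fun h h' => h (dvd_of_dvd_mul_modulus hdiv ht' ht hne h'), ?_⟩
      refine h2.imp (fun h => h.mul_right _) fun h => ?_
      rw [hk', mul_comm _ k'] at h
      exact dvd_of_dvd_mul_modulus hdiv ht' ht hne h

/-- Bounded `Σ⁰₁` comprehension. -/
theorem bounded_comprehension (F : N.Dom → Prop) [D1 fun e => F (e 0)] (b : N.Dom) :
    ∃ X : N.Sets, ∀ t, t ∈ X ↔ t < b ∧ F t := by
  obtain ⟨c, hc⟩ := exists_code F b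
  obtain ⟨X, hX⟩ := delta_comprehension (P := fun t => Elt t c)
  exact ⟨X, fun t => (hX t).trans (hc t)⟩

/-- An unbounded `Σ⁰₁` class has an unbounded subset. -/
theorem exists_unbounded_subset {R : N.Dom → N.Dom → Prop} [h : D0 fun e => R (e 0) (e 1)]
    (hR : ∀ b, ∃ x, b ≤ x ∧ ∃ w, R w x) :
    ∃ X : N.Sets, (∀ b, ∃ x, b ≤ x ∧ x ∈ X) ∧ ∀ x, x ∈ X → ∃ w, R w x := by
  -- The number `p` is a pair of an element `x ≥ b` of the class and a witness for `x`.
  let G : N.Dom → N.Dom → Prop := fun b p =>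
    ∃ x, x < p + 1 ∧ ∃ w, w < p + 1 ∧ p = pr x w ∧ R w x ∧ b ≤ x
  have hG : D0 fun e => G (e 0) (e 1) := by
    dsimp only [G]
    infer_instance
  have hG1 : D0 fun e => G (e 1) (e 0) := D0.comp₂ hG _ _
  have hG2 : D0 fun e => G (e 2) (e 0) := D0.comp₂ hG _ _
  have hpr : ∀ b x w, R w x → b ≤ x → G b (pr x w) := fun b x w hw hb =>
    ⟨x, Str.lt_succ_iff.2 (left_le_pr _ _), w, Str.lt_succ_iff.2 (right_le_pr _ _), rfl, hw, hb⟩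
  have hleast : ∀ b, ∃ p, G b p ∧ ∀ p', p' < p → ¬ G b p' := by
    intro b
    obtain ⟨x, hb, w, hw⟩ := hR b
    have : D0 fun e => G b (e 0) := D0.comp₂ hG _ _
    exact exists_least (hpr b x w hw hb)
  -- An element `x` is kept if the least `p` with `G x p` has `x` itself as first component. This
  -- least `p` always exists and is unique, so the complement is `Σ⁰₁` too.
  let P : N.Dom → Prop := fun x =>
    ∃ p, (G x p ∧ ∀ p', p' < p → ¬ G x p') ∧ ∃ w, w < p + 1 ∧ p = pr x w
  have hP : D1 fun e => P (e 0) := by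
    dsimp only [P]
    infer_instance
  have hP' : D1 fun e => ¬ P (e 0) := by
    refine (inferInstance : D1 fun e => ∃ p, (G (e 0) p ∧ ∀ p', p' < p → ¬ G (e 0) p') ∧
      ¬ ∃ w, w < p + 1 ∧ p = pr (e 0) w).congr fun e => ?_
    obtain ⟨p, hp, hpmin⟩ := hleast (e 0)
    have huniq : ∀ q, G (e 0) q ∧ (∀ p', p' < q → ¬ G (e 0) p') → q = p := by
      rintro q ⟨hq, hqmin⟩
      exact le_antisymm (not_lt.1 fun h => hqmin p h hp) (not_lt.1 fun h => hpmin q h hq)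
    constructor
    · exact fun h => ⟨p, ⟨hp, hpmin⟩, fun hw => h ⟨p, ⟨hp, hpmin⟩, hw⟩⟩
    · rintro ⟨q, hq, hw⟩ ⟨q', hq', hw'⟩
      rw [huniq q hq] at hw
      rw [huniq q' hq'] at hw'
      exact hw hw'
  obtain ⟨X, hX⟩ := delta_comprehension (P := P)
  refine ⟨X, fun b => ?_, fun x hx => ?_⟩
  · obtain ⟨p, ⟨x, hxp, w, hwp, rfl, hw, hb⟩, hmin⟩ := hleast b
    -- The least pair for `b` is also the least for its own first component `x`, since a pair for
    -- `x` is a pair for `b ≤ x`.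
    refine ⟨x, hb, (hX x).2 ⟨_, ⟨hpr x x w hw le_rfl, fun p' hp' => ?_⟩, w, hwp, rfl⟩⟩
    rintro ⟨x', -, w', -, rfl, hw', hx'⟩
    exact hmin _ hp' (hpr b x' w' hw' (hb.trans hx'))
  · obtain ⟨p, ⟨⟨x', -, w', -, rfl, hw', -⟩, -⟩, w, -, hpw⟩ := (hX x).1 hx
    obtain ⟨rfl, rfl⟩ := pr_inj.1 hpw
    exact ⟨_, hw'⟩

end Coding

section Satisfaction

variable {N : Str} [hN : N.IsRCA]

/-! ## Truth values -/

/-- The proposition `p` has the truth value `c`. -/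
def Val (c : Bool) (p : Prop) : Prop := if c then p else ¬ p

theorem val_not {c : Bool} {p : Prop} : Val (!c) p ↔ ¬ Val c p := by cases c <;> simp [Val]

theorem val_congr {c : Bool} {p q : Prop} (h : p ↔ q) : Val c p ↔ Val c q := by rw [h]

instance D0.val {c : Bool} {P : (ℕ → N.Dom) → Prop} [h : D0 P] : D0 fun e => Val c (P e) := by
  cases c
  · exact (inferInstance : D0 fun e => ¬ P e).congr fun e => by simp [Val]
  · exact h.congr fun e => by simp [Val]

/-- Conjunction for `c = true`, disjunction for `c = false`. -/
def comb (c : Bool) (p q : Prop) : Prop := if c then p ∧ q else p ∨ q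

instance D0.comb {c : Bool} {P Q : (ℕ → N.Dom) → Prop} [D0 P] [D0 Q] :
    D0 fun e => comb c (P e) (Q e) := by
  cases c
  · exact (inferInstance : D0 fun e => P e ∨ Q e).congr fun e => by simp [SOA.comb]
  · exact (inferInstance : D0 fun e => P e ∧ Q e).congr fun e => by simp [SOA.comb]

/-- The reason for choosing `comb`: one argument with the value opposite to `c` decides the result,
so values once achieved survive further combination. -/
theorem val_comb {c : Bool} {p q : Prop} :
    Val (!c) (comb c p q) ↔ Val (!c) p ∨ Val (!c) q := by
  cases c
  · simp [Val, comb]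
  · simp only [Val, comb]
    simp
    tauto

/-! ## Relations and formulas -/

/-- The vector `v` is in the relation `(n, r)`. -/
def VecMem (n r v : N.Dom) : Prop := ∃ u, Elt u r ∧ ∀ i, i < n → (Elt i u ↔ Elt i v)

def AtMostOne (p : N.Dom) : Prop := ∀ i j, Elt i p → Elt j p → i = j

def Below (p n : N.Dom) : Prop := ∀ i, Elt i p → i < n

/-- `h` is a conjunction of horn (`c = true`) or co-horn clauses in `n` variables. -/
def IsHornFormula (c : Bool) (n h : N.Dom) : Prop :=
  ∀ d, Elt d h → ∃ p q, d = pr p q ∧ Below p n ∧ Below q n ∧ AtMostOne (if c then p else q)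

/-- The vector `v` satisfies the conjunction of clauses `h`. -/
def CnfTrue (h v : N.Dom) : Prop :=
  ∀ p q, Elt (pr p q) h → (∃ i, Elt i p ∧ Elt i v) ∨ ∃ i, Elt i q ∧ ¬ Elt i v

/-- `t` codes a horn (`c = true`) or co-horn relation. -/
def IsHornRel (c : Bool) (t : N.Dom) : Prop :=
  ∃ n r h, t = pr n r ∧ IsHornFormula c n h ∧ ∀ v, VecMem n r v ↔ CnfTrue h v

/-- `t` is a formula over the set `V` of variables, with a relation in the class `R`. -/
def IsSFormula (R : N.Dom → Prop) (V : N.Sets) (t : N.Dom) : Prop :=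
  ∃ n r y, t = pr (pr n r) y ∧ R (pr n r) ∧
    ∀ i, i < n → ∃ z, z ∈ V ∧ ∀ w, Elt (pr i w) y ↔ w = z

/-- The assignment `X` satisfies the formula `t`. -/
def Sat (X : N.Dom → Prop) (t : N.Dom) : Prop :=
  ∃ n r y v, t = pr (pr n r) y ∧ VecMem n r v ∧
    ∀ i, i < n → (Elt i v ↔ ∃ z, Elt (pr i z) y ∧ X z)

/-- All quantifiers become bounded: the components of `t` are at most `t`, and the vector may be
replaced by the element `u` of `r` that agrees with it below `n`. -/
theorem sat_iff {X : N.Dom → Prop} {t : N.Dom} :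
    Sat X t ↔ ∃ n, n < t + 1 ∧ ∃ r, r < t + 1 ∧ ∃ y, y < t + 1 ∧ t = pr (pr n r) y ∧
      ∃ u, u < r ∧ Elt u r ∧ ∀ i, i < n → (Elt i u ↔ ∃ z, z < y ∧ Elt (pr i z) y ∧ X z) := by
  have hz : ∀ {i y}, (∃ z, Elt (pr i z) y ∧ X z) ↔ ∃ z, z < y ∧ Elt (pr i z) y ∧ X z :=
    ⟨fun ⟨z, h, hX⟩ => ⟨z, (right_le_pr _ _).trans_lt h.lt, h, hX⟩, fun ⟨z, _, h, hX⟩ => ⟨z, h, hX⟩⟩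
  simp only [Sat, hz]
  constructor
  · rintro ⟨n, r, y, v, rfl, ⟨u, hu, huv⟩, hv⟩
    refine ⟨n, ?_, r, ?_, y, ?_, rfl, u, hu.lt, hu, fun i hi => (huv i hi).trans (hv i hi)⟩ <;>
      rw [Str.lt_succ_iff]
    · exact (left_le_pr _ _).trans (left_le_pr _ _)
    · exact (right_le_pr _ _).trans (left_le_pr _ _)
    · exact right_le_pr _ _
  · rintro ⟨n, -, r, -, y, -, ht, u, -, hu, h⟩
    exact ⟨n, r, y, u, ht, ⟨u, hu, fun _ _ => Iff.rfl⟩, h⟩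

/-- Each variable in a formula is smaller than a code of the formula, hence only values below `t`
matter. -/
theorem sat_congr {X Y : N.Dom → Prop} {t : N.Dom} (h : ∀ z, z < t → (X z ↔ Y z)) :
    Sat X t ↔ Sat Y t := by
  have key : ∀ {X Y : N.Dom → Prop}, (∀ z, z < t → (X z ↔ Y z)) → Sat X t → Sat Y t := by
    rintro X Y h ⟨n, r, y, v, rfl, hv, hX⟩
    refine ⟨n, r, y, v, rfl, hv, fun i hi => (hX i hi).trans (exists_congr fun z => ?_)⟩
    refine and_congr_right fun hz => h z ?_
    exact ((right_le_pr _ _).trans_lt hz.lt).trans_le (right_le_pr _ _)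
  exact ⟨key h, key fun z hz => (h z hz).symm⟩

instance D0.sat {g g' : (ℕ → N.Dom) → N.Dom} [Poly g] [Poly g'] :
    D0 fun e => Sat (fun z => Elt z (g e)) (g' e) := by
  refine D0.comp₂ (R := fun x y => Sat (fun z => Elt z x) y) ?_ g g'
  simp only [sat_iff]
  infer_instance

/-- In the horn case, a negative literal true in one vector stays true in the intersection; if both
vectors use positive literals, it is the same literal, true in both. The co-horn case is dual. -/
theorem CnfTrue.comb {c : Bool} {n h v₁ v₂ v : N.Dom} (hh : IsHornFormula c n h)
    (h₁ : CnfTrue h v₁) (h₂ : CnfTrue h v₂)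
    (hv : ∀ i, i < n → (Elt i v ↔ comb c (Elt i v₁) (Elt i v₂))) : CnfTrue h v := by
  intro p q hpq
  obtain ⟨p', q', heq, hp, hq, hone⟩ := hh _ hpq
  obtain ⟨rfl, rfl⟩ := pr_inj.1 heq
  have h₁ := h₁ p q hpq
  have h₂ := h₂ p q hpq
  cases c
  · simp only [SOA.comb, Bool.false_eq_true, if_false] at hv hone
    rcases h₁ with ⟨i, hi, hi'⟩ | ⟨i, hi, hi'⟩
    · exact .inl ⟨i, hi, (hv i (hp i hi)).2 (.inl hi')⟩
    rcases h₂ with ⟨j, hj, hj'⟩ | ⟨j, hj, hj'⟩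
    · exact .inl ⟨j, hj, (hv j (hp j hj)).2 (.inr hj')⟩
    obtain rfl := hone i j hi hj
    exact .inr ⟨i, hi, fun h => ((hv i (hq i hi)).1 h).elim hi' hj'⟩
  · simp only [SOA.comb, if_true] at hv hone
    rcases h₁ with ⟨i, hi, hi'⟩ | ⟨i, hi, hi'⟩
    · rcases h₂ with ⟨j, hj, hj'⟩ | ⟨j, hj, hj'⟩
      · obtain rfl := hone i j hi hj
        exact .inl ⟨i, hi, (hv i (hp i hi)).2 ⟨hi', hj'⟩⟩
      · exact .inr ⟨j, hj, fun h => hj' ((hv j (hq j hj)).1 h).2⟩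
    · exact .inr ⟨i, hi, fun h => hi' ((hv i (hq i hi)).1 h).1⟩

/-- The assignments that satisfy a horn (co-horn) formula are closed under intersection (union). -/
theorem Sat.comb {c : Bool} {R : N.Dom → Prop} (hR : ∀ t, R t → IsHornRel c t) {V : N.Sets}
    {t : N.Dom} (ht : IsSFormula R V t) {X Y : N.Dom → Prop} (hX : Sat X t) (hY : Sat Y t) :
    Sat (fun z => comb c (X z) (Y z)) t := by
  obtain ⟨n, r, y, rfl, hr, hy⟩ := ht
  obtain ⟨n', r', h, hnr, hh, hcnf⟩ := hR _ hr
  obtain ⟨rfl, rfl⟩ := pr_inj.1 hnr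
  obtain ⟨n₁, r₁, y₁, v₁, heq₁, hv₁, hX⟩ := hX
  obtain ⟨n₂, r₂, y₂, v₂, heq₂, hv₂, hY⟩ := hY
  simp only [pr_inj] at heq₁ heq₂
  obtain ⟨⟨rfl, rfl⟩, rfl⟩ := heq₁
  obtain ⟨⟨rfl, rfl⟩, rfl⟩ := heq₂
  obtain ⟨v, hv⟩ := exists_code (fun i => SOA.comb c (Elt i v₁) (Elt i v₂)) n
  have hv' : ∀ i, i < n → (Elt i v ↔ SOA.comb c (Elt i v₁) (Elt i v₂)) := fun i hi => by
    simp [hv, hi]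
  refine ⟨n, r, y, v, rfl, (hcnf v).2 (((hcnf v₁).1 hv₁).comb hh ((hcnf v₂).1 hv₂) hv'),
    fun i hi => ?_⟩
  obtain ⟨z, -, hz⟩ := hy i hi
  -- The formula has exactly one variable `z` at place `i`, so the existential quantifier in `Sat`
  -- is evaluation at `z` and commutes with `comb`.
  have key : ∀ Z : N.Dom → Prop, (∃ w, Elt (pr i w) y ∧ Z w) ↔ Z z := fun Z => by simp [hz]
  rw [key, hv' i hi, hX i hi, hY i hi, key, key]

/-! ## Codes for all subsets of an initial segment -/

/-- The numbers below `B`, as codes of sets, contain the empty subset of `[0, k)`, and they are closed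
under the insertion of elements of `[0, k)`. -/
def Complete (k B : N.Dom) : Prop :=
  (∃ u, u < B ∧ ∀ i, i < k → ¬ Elt i u) ∧ ∀ u, u < B → ∀ z, z < k →
    ∃ u', u' < B ∧ ∀ i, i < k → (Elt i u' ↔ Elt i u ∨ i = z)

instance D0.complete {g g' : (ℕ → N.Dom) → N.Dom} [Poly g] [Poly g'] :
    D0 fun e => Complete (g e) (g' e) := by
  refine D0.comp₂ (R := fun x y => Complete x y) ?_ g g'
  unfold Complete
  infer_instance

/-- The elements are inserted one by one, never leaving the codes below `B`. Replacing `F` by a code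
`c` first makes the induction formula bounded. -/
theorem Complete.exists_code {k B : N.Dom} (h : Complete k B) (F : N.Dom → Prop)
    [D1 fun e => F (e 0)] : ∃ u, u < B ∧ ∀ i, i < k → (Elt i u ↔ F i) := by
  obtain ⟨c, hc⟩ := SOA.exists_code F k
  have : ∃ u, u < B ∧ ∀ i, i < k → (Elt i u ↔ i < k ∧ Elt i c) := by
    refine Str.delta_induction
      (P := fun j => ∃ u, u < B ∧ ∀ i, i < k → (Elt i u ↔ i < j ∧ Elt i c)) ?_ ?_ k
    · obtain ⟨u, hu, h0⟩ := h.1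
      exact ⟨u, hu, fun i hi => by simp [h0 i hi]⟩
    · rintro j ⟨u, hu, hj⟩
      by_cases hjc : j < k ∧ Elt j c
      · obtain ⟨u', hu', h'⟩ := h.2 u hu j hjc.1
        refine ⟨u', hu', fun i hi => ?_⟩
        rw [h' i hi, hj i hi, Str.lt_succ_iff, le_iff_lt_or_eq]
        constructor
        · rintro (h | rfl)
          · exact ⟨.inl h.1, h.2⟩
          · exact ⟨.inr rfl, hjc.2⟩
        · rintro ⟨h | h, h'⟩
          · exact .inl ⟨h, h'⟩
          · exact .inr h
      · refine ⟨u, hu, fun i hi => ?_⟩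
        rw [hj i hi, Str.lt_succ_iff, le_iff_lt_or_eq]
        refine and_congr_left fun hic => ⟨.inl, fun h => h.resolve_right ?_⟩
        rintro rfl
        exact hjc ⟨hi, hic⟩
  obtain ⟨u, hu, h⟩ := this
  exact ⟨u, hu, fun i hi => by simp [h i hi, hc, hi]⟩

/-- Completeness is a bounded property, so `Σ⁰₁` induction on `k` applies. Each code below `B`
extends to `[0, k]` in two ways, without and with `k`, and collection bounds the new codes. -/
theorem exists_complete (k : N.Dom) : ∃ B, Complete k B := by
  refine sigma_induction (P := fun k : N.Dom => ∃ B, Complete k B) ?_ ?_ k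
  · exact ⟨1, ⟨0, zero_lt_one, fun i hi => (not_lt_zero hi).elim⟩,
      fun _ _ z hz => (not_lt_zero hz).elim⟩
  rintro k ⟨B, hB⟩
  have hcol : ∃ B', ∀ u, u < B → ∃ v, v < B' ∧ (∀ i, i < k → (Elt i v ↔ Elt i u)) ∧ ¬ Elt k v := by
    refine collection (R := fun v u => (∀ i, i < k → (Elt i v ↔ Elt i u)) ∧ ¬ Elt k v) B
      fun u _ => ?_
    obtain ⟨v, hv⟩ := exists_code (fun i => Elt i u) k
    exact ⟨v, fun i hi => by simp [hv, hi], by simp [hv]⟩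
  have hcol' : ∃ B', ∀ u, u < B → ∃ v, v < B' ∧ (∀ i, i < k → (Elt i v ↔ Elt i u)) ∧ Elt k v := by
    refine collection (R := fun v u => (∀ i, i < k → (Elt i v ↔ Elt i u)) ∧ Elt k v) B fun u _ => ?_
    obtain ⟨v, hv⟩ := exists_code (fun i => Elt i u ∨ i = k) (k + 1)
    exact ⟨v, fun i hi => by simp [hv, hi.ne, hi.trans (lt_add_one k)], by simp [hv]⟩
  obtain ⟨B₁, h₁⟩ := hcol
  obtain ⟨B₂, h₂⟩ := hcol'
  have key : ∀ (F : N.Dom → Prop) [D1 fun e => F (e 0)],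
      ∃ v, v < max B₁ B₂ ∧ ∀ i, i < k + 1 → (Elt i v ↔ F i) := by
    intro F _
    obtain ⟨u, hu, huF⟩ := hB.exists_code F
    by_cases hk : F k
    · obtain ⟨v, hv, hvu, hkv⟩ := h₂ u hu
      refine ⟨v, lt_max_of_lt_right hv, fun i hi => ?_⟩
      rcases (Str.lt_succ_iff.1 hi).lt_or_eq with hi | rfl
      · rw [hvu i hi, huF i hi]
      · simp [hkv, hk]
    · obtain ⟨v, hv, hvu, hkv⟩ := h₁ u hu
      refine ⟨v, lt_max_of_lt_left hv, fun i hi => ?_⟩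
      rcases (Str.lt_succ_iff.1 hi).lt_or_eq with hi | rfl
      · rw [hvu i hi, huF i hi]
      · simp [hkv, hk]
  refine ⟨max B₁ B₂, ?_, fun u _ z _ => key fun i => Elt i u ∨ i = z⟩
  obtain ⟨v, hv, h⟩ := key fun _ => False
  exact ⟨v, hv, fun i hi => by simp [h i hi]⟩

end Satisfaction

section Homogeneous

variable {N : Str} [hN : N.IsRCA]

/-! ## Homogeneous sets -/

def Bdd (F : N.Dom → Prop) : Prop := ∃ b, ∀ x, F x → x < b

theorem not_bdd_iff {F : N.Dom → Prop} : ¬ Bdd F ↔ ∀ b, ∃ x, b ≤ x ∧ F x := by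
  simp only [Bdd, not_exists, not_forall, not_lt]
  exact forall_congr' fun b => exists_congr fun x =>
    ⟨fun ⟨h, h'⟩ => ⟨h', h⟩, fun ⟨h, h'⟩ => ⟨h', h⟩⟩

def SatAll (X F : N.Sets) : Prop := ∀ t, t ∈ F → Sat (· ∈ X) t

/-- `F` is a finite subset of `C`. -/
def FinSub (F C : N.Sets) : Prop := (∀ x, x ∈ F → x ∈ C) ∧ Bdd (· ∈ F)

def FinSat (C : N.Sets) : Prop := ∀ F, FinSub F C → ∃ X, SatAll X F

def HomogeneousWith (c : Bool) (H C : N.Sets) : Prop :=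
  ∀ F, FinSub F C → ∃ X, SatAll X F ∧ ∀ a, a ∈ H → Val c (a ∈ X)

/-- Some finite subset of `C` forces `x` to have the value `c`. -/
def Forced (c : Bool) (C L : N.Sets) (x : N.Dom) : Prop :=
  x ∈ L ∧ ∃ F, FinSub F C ∧ ∀ X, SatAll X F → Val c (x ∈ X)

/-- The finite set coded by `u` satisfies the formulas in `C` below `k`. -/
def SatBelow (C : N.Sets) (k u : N.Dom) : Prop := ∀ t, t < k → t ∈ C → Sat (fun z => Elt z u) t

instance D0.satBelow (C : N.Sets) {g g' : (ℕ → N.Dom) → N.Dom} [Poly g] [Poly g'] :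
    D0 fun e => SatBelow C (g e) (g' e) := by
  refine D0.comp₂ (R := fun x y => SatBelow C x y) ?_ g g'
  unfold SatBelow
  infer_instance

/-- The bound `w` allows to verify that `x` is forced to have the value `c`. -/
def ForcedBy (c : Bool) (C L : N.Sets) (w x : N.Dom) : Prop :=
  x ∈ L ∧ ∃ k, k < w ∧ ∃ B, B < w ∧ x < k ∧ Complete k B ∧
    ∀ u, u < B → SatBelow C k u → Val c (Elt x u)

instance D0.forcedBy (c : Bool) (C L : N.Sets) {g g' : (ℕ → N.Dom) → N.Dom} [Poly g] [Poly g'] :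
    D0 fun e => ForcedBy c C L (g e) (g' e) := by
  refine D0.comp₂ (R := fun x y => ForcedBy c C L x y) ?_ g g'
  unfold ForcedBy
  infer_instance

variable {c : Bool} {R : N.Dom → Prop} {V C L : N.Sets}

theorem exists_finSub (C : N.Sets) (k : N.Dom) :
    ∃ F, FinSub F C ∧ ∀ t, t ∈ F ↔ t < k ∧ t ∈ C := by
  obtain ⟨F, hF⟩ := bounded_comprehension (· ∈ C) k
  exact ⟨F, ⟨fun x hx => ((hF x).1 hx).2, k, fun x hx => ((hF x).1 hx).1⟩, hF⟩

theorem exists_set_elt (u : N.Dom) : ∃ X : N.Sets, ∀ z, z ∈ X ↔ Elt z u :=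
  delta_comprehension

theorem FinSat.exists_sat (h : FinSat C) (k : N.Dom) :
    ∃ X : N.Sets, ∀ t, t < k → t ∈ C → Sat (· ∈ X) t := by
  obtain ⟨F, hF, hmem⟩ := exists_finSub C k
  obtain ⟨X, hX⟩ := h F hF
  exact ⟨X, fun t ht htC => hX t ((hmem t).2 ⟨ht, htC⟩)⟩

theorem Complete.exists_satBelow {k B : N.Dom} (hB : Complete k B) {X : N.Sets}
    (hX : ∀ t, t < k → t ∈ C → Sat (· ∈ X) t) :
    ∃ u, u < B ∧ SatBelow C k u ∧ ∀ i, i < k → (Elt i u ↔ i ∈ X) := by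
  obtain ⟨u, hu, h⟩ := hB.exists_code (· ∈ X)
  exact ⟨u, hu, fun t ht htC => (sat_congr fun z hz => h z (hz.trans ht)).2 (hX t ht htC), h⟩

theorem ForcedBy.exists_val {w x : N.Dom} (h : ForcedBy c C L w x) {X : N.Sets}
    (hX : ∀ t, t < w → t ∈ C → Sat (· ∈ X) t) : Val c (x ∈ X) := by
  obtain ⟨-, k, hk, B, -, hxk, hB, h⟩ := h
  obtain ⟨u, hu, hsat, hiff⟩ := hB.exists_satBelow fun t ht => hX t (ht.trans hk)
  exact (val_congr (hiff x hxk)).1 (h u hu hsat)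

/-- Every code is the code of an actual set, so a statement about all sets covers the codes below
`B`. The segment `max b (x + 1)` contains `x` as well as the relevant formulas. -/
theorem exists_forcedBy {x : N.Dom} (hx : x ∈ L) {b : N.Dom}
    (h : ∀ X : N.Sets, (∀ t, t < b → t ∈ C → Sat (· ∈ X) t) → Val c (x ∈ X)) :
    ∃ w, ForcedBy c C L w x := by
  obtain ⟨B, hB⟩ := exists_complete (max b (x + 1))
  refine ⟨max (max b (x + 1)) B + 1, hx, _, Str.lt_succ_iff.2 (le_max_left _ _), B,
    Str.lt_succ_iff.2 (le_max_right _ _), lt_max_of_lt_right (lt_add_one x), hB,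
    fun u _ hsat => ?_⟩
  obtain ⟨X, hX⟩ := exists_set_elt u
  refine (val_congr (hX x)).1 (h X fun t ht htC => ?_)
  exact (sat_congr fun z _ => hX z).2 (hsat t (lt_max_of_lt_left ht) htC)

/-- Finite subsets of `C` may be enlarged to initial segments, and assignments cut down to codes
below `B`; so being forced is `Σ⁰₁`, whatever the relations are. -/
theorem forced_iff {x : N.Dom} : Forced c C L x ↔ ∃ w, ForcedBy c C L w x := by
  constructor
  · rintro ⟨hx, F, ⟨hFC, b, hb⟩, h⟩
    exact exists_forcedBy hx fun X hX => h X fun t ht => hX t (hb t ht) (hFC t ht)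
  · rintro ⟨w, hw⟩
    obtain ⟨F, hF, hmem⟩ := exists_finSub C w
    exact ⟨hw.1, F, hF, fun X hX => hw.exists_val fun t ht htC => hX t ((hmem t).2 ⟨ht, htC⟩)⟩

/-- The assignment `X` may be given the value `c` from `b` on. -/
theorem exists_override (c : Bool) (X : N.Sets) (b : N.Dom) :
    ∃ Y : N.Sets, (∀ z, z < b → (z ∈ Y ↔ z ∈ X)) ∧ ∀ z, b ≤ z → Val c (z ∈ Y) := by
  cases c
  · obtain ⟨Y, hY⟩ := delta_comprehension (P := fun z => z ∈ X ∧ z < b)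
    exact ⟨Y, fun z hz => by simp [hY, hz], fun z hz => by simp [Val, hY, hz]⟩
  · obtain ⟨Y, hY⟩ := delta_comprehension (P := fun z => z ∈ X ∨ b ≤ z)
    exact ⟨Y, fun z hz => by simp [hY, hz], fun z hz => by simp [Val, hY, hz]⟩

/-- It suffices to find the assignments of a homogeneous set on initial segments. -/
theorem homogeneousWith_of_forall {H : N.Sets} (h : ∀ b : N.Dom, ∃ X : N.Sets,
    (∀ t, t < b → t ∈ C → Sat (· ∈ X) t) ∧ ∀ a, a < b → a ∈ H → Val c (a ∈ X)) :
    HomogeneousWith c H C := by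
  rintro F ⟨hFC, b, hb⟩
  obtain ⟨X, hX, hval⟩ := h b
  obtain ⟨Y, hlt, hge⟩ := exists_override c X b
  refine ⟨Y, fun t ht => ?_, fun a ha => ?_⟩
  · exact (sat_congr fun z hz => hlt z (hz.trans (hb t ht))).2 (hX t (hb t ht) (hFC t ht))
  · rcases lt_or_ge a b with hab | hab
    · exact (val_congr (hlt a hab)).2 (hval a hab ha)
    · exact hge a hab

/-- Collection gives a common bound `B` for the witnesses of the elements below `b`; an assignment
satisfying `C` below `B` then has the right value at all of them. -/
theorem homogeneousWith_of_forced (hC : FinSat C) {H : N.Sets} (hH : ∀ x, x ∈ H → Forced c C L x) :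
    HomogeneousWith c H C := by
  refine homogeneousWith_of_forall fun b => ?_
  obtain ⟨B, hB⟩ := collection (R := fun w x => x ∈ H → ForcedBy c C L w x) b fun x _ => by
    by_cases hx : x ∈ H
    · obtain ⟨w, hw⟩ := forced_iff.1 (hH x hx)
      exact ⟨w, fun _ => hw⟩
    -- A dummy witness outside `H`, as collection needs one for every `x < b`.
    · exact ⟨0, fun h => (hx h).elim⟩
  obtain ⟨X, hX⟩ := hC.exists_sat (max b B)
  refine ⟨X, fun t ht => hX t (lt_max_of_lt_left ht), fun a hab ha => ?_⟩
  obtain ⟨w, hw, h⟩ := hB a hab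
  exact (h ha).exists_val fun t ht => hX t (lt_max_of_lt_right (ht.trans hw))

/-- The elements of `H` below `b` are treated in turn: an unforced `j` has the opposite value in
some assignment satisfying `C` below `b`, and combining it with the current one fixes `j` without
losing earlier elements. -/
theorem homogeneousWith_of_not_forced (hR : ∀ t, R t → IsHornRel c t)
    (hform : ∀ t, t ∈ C → IsSFormula R V t) (hC : FinSat C) {H : N.Sets}
    (hH : ∀ x, x ∈ H → x ∈ L ∧ ¬ Forced c C L x) : HomogeneousWith (!c) H C := by
  refine homogeneousWith_of_forall fun b => ?_
  obtain ⟨B, hB⟩ := exists_complete b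
  -- The bound `u < B` keeps the induction formula bounded. The first `z < b` becomes `z < j` in the
  -- induction.
  have key : ∃ u, u < B ∧ SatBelow C b u ∧ ∀ z, z < b → z < b → z ∈ H → Val (!c) (Elt z u) := by
    refine Str.delta_induction (P := fun j => ∃ u, u < B ∧ SatBelow C b u ∧
      ∀ z, z < j → z < b → z ∈ H → Val (!c) (Elt z u)) ?_ ?_ b
    · obtain ⟨X, hX⟩ := hC.exists_sat b
      obtain ⟨u, hu, hsat, -⟩ := hB.exists_satBelow hX
      exact ⟨u, hu, hsat, fun z hz => (not_lt_zero hz).elim⟩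
    rintro j ⟨u, hu, hsat, hval⟩
    by_cases hj : j < b ∧ j ∈ H
    · have hX : ∃ X : N.Sets, (∀ t, t < b → t ∈ C → Sat (· ∈ X) t) ∧ ¬ Val c (j ∈ X) := by
        by_contra! h
        exact (hH j hj.2).2 (forced_iff.2 (exists_forcedBy (hH j hj.2).1 h))
      obtain ⟨X, hX, hjX⟩ := hX
      obtain ⟨v, hv, hvb⟩ := hB.exists_code fun z => comb c (Elt z u) (z ∈ X)
      refine ⟨v, hv, fun t ht htC => ?_, fun z hz hzb hzH => ?_⟩
      · exact (sat_congr fun z hz => hvb z (hz.trans ht)).2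
          ((hsat t ht htC).comb hR (hform t htC) (hX t ht htC))
      · rw [val_congr (hvb z hzb), val_comb]
        rcases (Str.lt_succ_iff.1 hz).lt_or_eq with hz | rfl
        · exact .inl (hval z hz hzb hzH)
        · exact .inr (val_not.2 hjX)
    · refine ⟨u, hu, hsat, fun z hz hzb hzH => ?_⟩
      rcases (Str.lt_succ_iff.1 hz).lt_or_eq with hz | rfl
      · exact hval z hz hzb hzH
      · exact (hj ⟨hzb, hzH⟩).elim
  obtain ⟨u, -, hsat, hval⟩ := key
  obtain ⟨X, hX⟩ := exists_set_elt u
  refine ⟨X, fun t ht htC => (sat_congr fun z _ => hX z).2 (hsat t ht htC), fun a ha haH => ?_⟩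
  exact (val_congr (hX a)).2 (hval a ha ha haH)

/-- A bounded `Σ⁰₁` class is a set, so its complement in `L` exists; an unbounded one contains an
unbounded set. -/
theorem exists_homogeneous (hR : ∀ t, R t → IsHornRel c t)
    (hform : ∀ t, t ∈ C → IsSFormula R V t) (hC : FinSat C) (hL : ¬ Bdd (· ∈ L)) :
    ∃ H : N.Sets, ¬ Bdd (· ∈ H) ∧ (∀ x, x ∈ H → x ∈ L) ∧
      ((¬ Bdd (Forced c C L) ∧ (∀ x, x ∈ H → Forced c C L x) ∧ HomogeneousWith c H C) ∨
        (Bdd (Forced c C L) ∧ (∀ x, x ∈ H ↔ x ∈ L ∧ ¬ Forced c C L x) ∧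
          HomogeneousWith (!c) H C)) := by
  by_cases hF : Bdd (Forced c C L)
  · obtain ⟨b, hb⟩ := hF
    obtain ⟨F, hFmem⟩ := bounded_comprehension (fun x => ∃ w, ForcedBy c C L w x) b
    obtain ⟨H, hH⟩ := delta_comprehension (P := fun x => x ∈ L ∧ ¬ x ∈ F)
    have hH' : ∀ x, x ∈ H ↔ x ∈ L ∧ ¬ Forced c C L x := fun x => by
      rw [hH, hFmem, ← forced_iff]
      exact and_congr_right fun _ => not_congr (and_iff_right_of_imp (hb x))
    refine ⟨H, not_bdd_iff.2 fun a => ?_, fun x hx => ((hH x).1 hx).1,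
      .inr ⟨⟨b, hb⟩, hH', homogeneousWith_of_not_forced hR hform hC fun x => (hH' x).1⟩⟩
    obtain ⟨x, hx, hxL⟩ := not_bdd_iff.1 hL (max a b)
    exact ⟨x, (le_max_left _ _).trans hx, (hH' x).2 ⟨hxL, fun h =>
      (hb x h).not_ge ((le_max_right _ _).trans hx)⟩⟩
  · obtain ⟨H, hH, hsub⟩ := exists_unbounded_subset (R := fun w x => ForcedBy c C L w x) (by
      simpa only [forced_iff] using not_bdd_iff.1 hF)
    have hsub' : ∀ x, x ∈ H → Forced c C L x := fun x hx => forced_iff.2 (hsub x hx)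
    exact ⟨H, not_bdd_iff.2 hH, fun x hx => (hsub' x hx).1,
      .inl ⟨hF, hsub', homogeneousWith_of_forced hC hsub'⟩⟩

end Homogeneous

/-! ## Evaluation of the formulas about satisfiability -/

attribute [simp] scons_zero scons_succ Tm.val_var Tm.val_zero Tm.val_one Tm.val_add Tm.val_mul
  Tm.val_up Fm.holds_eq Fm.holds_lt Fm.holds_mem Fm.holds_imp Fm.holds_all
  Fm.holds_allS Fm.holds_neg Fm.holds_and Fm.holds_or Fm.holds_iff Fm.holds_ex Fm.holds_exS
  Fm.holds_at

section Evaluation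

variable {N : Str} (e : ℕ → N.Dom) (f : ℕ → N.Sets)

@[simp] theorem val_pair (t u : Tm) : (pair t u).val e = pr (t.val e) (u.val e) := by
  simp [pair, pr]

@[simp] theorem holds_elt (t c : Tm) : (elt t c).Holds e f ↔ Elt (t.val e) (c.val e) := by
  simp [elt, Elt]

@[simp] theorem holds_vecMem (n r v : Tm) :
    (vecMem n r v).Holds e f ↔ VecMem (n.val e) (r.val e) (v.val e) := by
  simp [vecMem, VecMem]

@[simp] theorem holds_atMostOne (p : Tm) : (atMostOne p).Holds e f ↔ AtMostOne (p.val e) := by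
  simp [atMostOne, AtMostOne]

@[simp] theorem holds_below (p n : Tm) : (below p n).Holds e f ↔ Below (p.val e) (n.val e) := by
  simp [below, Below]

@[simp] theorem holds_isHornFormula (c : Bool) (n h : Tm) :
    (isHornFormula c n h).Holds e f ↔ IsHornFormula c (n.val e) (h.val e) := by
  cases c <;> simp [isHornFormula, IsHornFormula]

@[simp] theorem holds_cnfTrue (h v : Tm) :
    (cnfTrue h v).Holds e f ↔ CnfTrue (h.val e) (v.val e) := by
  simp [cnfTrue, CnfTrue]

@[simp] theorem holds_isHornRel (c : Bool) (t : Tm) :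
    (isHornRel c t).Holds e f ↔ IsHornRel c (t.val e) := by
  simp [isHornRel, IsHornRel]

@[simp] theorem holds_isSFormula (σ : Fm) (k s V : ℕ) (t : Tm) :
    (isSFormula σ k s V t).Holds e f ↔
      IsSFormula (fun x => σ.Holds (scons x fun i => e (i + k)) fun i => f (i + s)) (f V)
        (t.val e) := by
  simp [isSFormula, IsSFormula, ← add_assoc]

@[simp] theorem holds_sat (X : ℕ) (t : Tm) : (sat X t).Holds e f ↔ Sat (· ∈ f X) (t.val e) := by
  simp [sat, Sat]

@[simp] theorem holds_subset (X Y : ℕ) :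
    (subset X Y).Holds e f ↔ ∀ x, x ∈ f X → x ∈ f Y := by
  simp [subset]

@[simp] theorem holds_finClass (φ : Fm) :
    (finClass φ).Holds e f ↔ Bdd fun x => φ.Holds (scons x e) f := by
  simp [finClass, Bdd]

@[simp] theorem holds_finite (X : ℕ) : (finite X).Holds e f ↔ Bdd (· ∈ f X) := by
  simp [finite]

@[simp] theorem holds_infinite (X : ℕ) : (infinite X).Holds e f ↔ ¬ Bdd (· ∈ f X) := by
  simp [infinite]

@[simp] theorem holds_satAll (X C : ℕ) : (satAll X C).Holds e f ↔ SatAll (f X) (f C) := by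
  simp [satAll, SatAll]

@[simp] theorem holds_finSat (C : ℕ) : (finSat C).Holds e f ↔ FinSat (f C) := by
  simp [finSat, FinSat, FinSub]

@[simp] theorem holds_hasValue (c : Bool) (X : ℕ) (t : Tm) :
    (hasValue c X t).Holds e f ↔ Val c (t.val e ∈ f X) := by
  cases c <;> simp [hasValue, Val]

@[simp] theorem holds_homogeneousWith (c : Bool) (H C : ℕ) :
    (homogeneousWith c H C).Holds e f ↔ HomogeneousWith c (f H) (f C) := by
  simp [homogeneousWith, HomogeneousWith, FinSub]

@[simp] theorem holds_forced (c : Bool) (C L : ℕ) :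
    (forced c C L).Holds e f ↔ Forced c (f C) (f L) (e 0) := by
  simp [forced, Forced, FinSub, and_assoc]

@[simp] theorem holds_allHorn (c : Bool) (σ : Fm) :
    (allHorn c σ).Holds e f ↔ ∀ t, σ.Holds (scons t e) f → IsHornRel c t := by
  simp [allHorn]

theorem holds_isInstance (σ : Fm) (V C L : N.Sets) :
    (isInstance σ).Holds e (scons L (scons C (scons V f))) ↔
      ¬ Bdd (· ∈ V) ∧ (∀ t, t ∈ C → IsSFormula (fun x => σ.Holds (scons x e) f) V t) ∧
        FinSat C ∧ ¬ Bdd (· ∈ L) ∧ ∀ x, x ∈ L → x ∈ V := by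
  simp [isInstance]

end Evaluation

/-! ## The `Σ⁰₁` definition of the forced variables -/

/-- `∃ x < t, φ` -/
def bexF (t : Tm) (φ : Fm) : Fm := (♯0 ≺ t.up 1 ➔ φ.neg).all.neg

/-- `∀ x < t, φ` -/
def ballF (t : Tm) (φ : Fm) : Fm := (♯0 ≺ t.up 1 ➔ φ).all

theorem IsBounded.neg {φ : Fm} (h : IsBounded φ) : IsBounded φ.neg := h.imp .bot

theorem IsBounded.and {φ ψ : Fm} (h : IsBounded φ) (h' : IsBounded ψ) : IsBounded (φ ⋏ ψ) :=
  (h.imp h'.neg).neg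

theorem IsBounded.or {φ ψ : Fm} (h : IsBounded φ) (h' : IsBounded ψ) : IsBounded (φ ⋎ ψ) :=
  h.neg.imp h'

theorem IsBounded.iff {φ ψ : Fm} (h : IsBounded φ) (h' : IsBounded ψ) : IsBounded (φ ⟺ ψ) :=
  (h.imp h').and (h'.imp h)

theorem IsBounded.bexF {φ : Fm} (t : Tm) (h : IsBounded φ) : IsBounded (bexF t φ) :=
  (IsBounded.ball t h.neg).neg

theorem IsBounded.ballF {φ : Fm} (t : Tm) (h : IsBounded φ) : IsBounded (ballF t φ) := .ball t h

/-- `elt` as a bounded formula. -/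
def eltF (t c : Tm) : Fm :=
  bexF (c + 1) (bexF (c.up 1 + 1) (bexF (c.up 2 + 1)
    (c.up 3 ≐ pair ♯2 (pair ♯1 ♯0) ⋏ t.up 3 ≺ ♯2 ⋏
      bexF (♯0 + 1) ((♯2 * (t.up 4 + 1) + 1) * ♯0 ≐ ♯1))))

/-- The finite set coded by `u` satisfies the formula `t`. -/
def satF (u t : Tm) : Fm :=
  bexF (t + 1) (bexF (t.up 1 + 1) (bexF (t.up 2 + 1)
    (t.up 3 ≐ pair (pair ♯2 ♯1) ♯0 ⋏ bexF ♯1 (eltF ♯0 ♯2 ⋏ ballF ♯3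
      (eltF ♯0 ♯1 ⟺ bexF ♯2 (eltF (pair ♯1 ♯0) ♯3 ⋏ eltF ♯0 (u.up 6)))))))

/-- Each subset of `[0, k)` has a code below `b`. -/
def completeF (k b : Tm) : Fm :=
  bexF b (ballF (k.up 1) (eltF ♯0 ♯1).neg) ⋏
    ballF b (ballF (k.up 1) (bexF (b.up 2) (ballF (k.up 3) (eltF ♯0 ♯1 ⟺ (eltF ♯0 ♯3 ⋎ ♯0 ≐ ♯2)))))

/-- The finite set coded by `u` satisfies the formulas below `k` in the set `C`. -/
def satBelowF (C : ℕ) (k u : Tm) : Fm := ballF k (♯0 ε C ➔ satF (u.up 1) ♯0)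

/-- The matrix of the `Σ⁰₁` definition of `forced c 1 0`. -/
def forcedByF (c : Bool) : Fm :=
  -- Here `♯0` is the witness `w` and `♯1` is `x`. The quantifiers introduce `k`, `B` and `u` in
  -- this order, and the set variables `1` and `0` are `C` and `L`.
  ♯1 ε 0 ⋏ bexF ♯0 (bexF ♯1 (♯3 ≺ ♯1 ⋏ completeF ♯1 ♯0 ⋏
    ballF ♯0 (satBelowF 1 ♯2 ♯0 ➔ if c then eltF ♯4 ♯0 else (eltF ♯4 ♯0).neg)))

theorem isBounded_eltF (t c : Tm) : IsBounded (eltF t c) :=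
  .bexF _ (.bexF _ (.bexF _ (.and (.eq _ _) (.and (.lt _ _) (.bexF _ (.eq _ _))))))

theorem isBounded_satF (u t : Tm) : IsBounded (satF u t) :=
  .bexF _ (.bexF _ (.bexF _ (.and (.eq _ _) (.bexF _ (.and (isBounded_eltF _ _) (.ballF _
    (.iff (isBounded_eltF _ _) (.bexF _ (.and (isBounded_eltF _ _) (isBounded_eltF _ _))))))))))

theorem isBounded_completeF (k b : Tm) : IsBounded (completeF k b) :=
  .and (.bexF _ (.ballF _ (isBounded_eltF _ _).neg)) (.ballF _ (.ballF _ (.bexF _ (.ballF _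
    (.iff (isBounded_eltF _ _) (.or (isBounded_eltF _ _) (.eq _ _)))))))

theorem isBounded_satBelowF (C : ℕ) (k u : Tm) : IsBounded (satBelowF C k u) :=
  .ballF _ (.imp (.mem _ _) (isBounded_satF _ _))

theorem isBounded_forcedByF (c : Bool) : IsBounded (forcedByF c) := by
  refine .and (.mem _ _) (.bexF _ (.bexF _ (.and (.lt _ _) (.and (isBounded_completeF _ _)
    (.ballF _ (.imp (isBounded_satBelowF _ _ _) ?_))))))
  cases c
  · exact (isBounded_eltF _ _).neg
  · exact isBounded_eltF _ _

section Definition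

variable {N : Str} (e : ℕ → N.Dom) (f : ℕ → N.Sets)

@[simp] theorem holds_bexF (t : Tm) (φ : Fm) :
    (bexF t φ).Holds e f ↔ ∃ x, x < t.val e ∧ φ.Holds (scons x e) f := by
  simp [bexF]

@[simp] theorem holds_ballF (t : Tm) (φ : Fm) :
    (ballF t φ).Holds e f ↔ ∀ x, x < t.val e → φ.Holds (scons x e) f := by
  simp [ballF]

variable [hN : N.IsRCA]

-- The bounds lose nothing: components of a pair are at most its code, and a quotient by a nonzero
-- modulus is at most the dividend.
@[simp] theorem holds_eltF (t c : Tm) : (eltF t c).Holds e f ↔ Elt (t.val e) (c.val e) := by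
  simp only [eltF, holds_bexF, Fm.holds_and, Fm.holds_eq, Fm.holds_lt, Tm.val_add, Tm.val_up,
    Tm.val_one, Tm.val_var, Tm.val_mul, scons_zero, scons_succ, val_pair]
  constructor
  · rintro ⟨k, -, m, -, n, -, hc, ht, q, -, hq⟩
    exact ⟨k, m, n, hc, ht, q, hq⟩
  · rintro ⟨k, m, n, hc, ht, q, hq⟩
    refine ⟨k, ?_, m, ?_, n, ?_, hc, ht, q, ?_, hq⟩ <;> rw [Str.lt_succ_iff]
    · rw [hc]
      exact left_le_pr _ _
    · rw [hc]
      exact (left_le_pr _ _).trans (right_le_pr _ _)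
    · rw [hc]
      exact (right_le_pr _ _).trans (right_le_pr _ _)
    · rw [← hq]
      exact le_mul_of_one_le_left zero_le (by simp)

@[simp] theorem holds_satF (u t : Tm) :
    (satF u t).Holds e f ↔ Sat (fun z => Elt z (u.val e)) (t.val e) := by
  simp [satF, sat_iff]

@[simp] theorem holds_completeF (k b : Tm) :
    (completeF k b).Holds e f ↔ Complete (k.val e) (b.val e) := by
  simp [completeF, Complete]

@[simp] theorem holds_satBelowF (C : ℕ) (k u : Tm) :
    (satBelowF C k u).Holds e f ↔ SatBelow (f C) (k.val e) (u.val e) := by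
  simp [satBelowF, SatBelow]

theorem holds_forcedByF (c : Bool) :
    (forcedByF c).Holds e f ↔ ForcedBy c (f 1) (f 0) (e 0) (e 1) := by
  cases c <;> simp [forcedByF, ForcedBy, Val]

end Definition

/-! ## The theorem -/

theorem proves_LRSATForced (c : Bool) (σ : Fm) :
    Proves RCA0 (allHorn c σ ➔ LRSATForced c (forcedByF c).ex σ) := by
  refine proves_of_models fun N hN e f => ?_
  have : N.IsRCA := ⟨hN⟩
  simp only [LRSATForced, Fm.holds_imp, holds_allHorn, Fm.holds_allS, holds_isInstance]
  rintro hR V C L ⟨-, hform, hC, hL, -⟩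
  refine (Fm.holds_and _ _ _ _).2 ⟨?_, ?_⟩
  · simp [holds_forcedByF, forced_iff]
  · simpa using exists_homogeneous hR hform hC hL

theorem proves_LRSAT (c : Bool) (σ : Fm) : Proves RCA0 (allHorn c σ ➔ LRSAT σ) := by
  refine proves_of_models fun N hN e f => ?_
  have : N.IsRCA := ⟨hN⟩
  simp only [LRSAT, Fm.holds_imp, holds_allHorn, Fm.holds_allS, holds_isInstance]
  rintro hR V C L ⟨-, hform, hC, hL, -⟩
  obtain ⟨H, hinf, hsub, h⟩ := exists_homogeneous hR hform hC hL
  have : HomogeneousWith false H C ∨ HomogeneousWith true H C := by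
    cases c
    · exact h.imp (fun h => h.2.2) fun h => h.2.2
    · exact h.symm.imp (fun h => h.2.2) fun h => h.2.2
  simpa [homogeneous] using ⟨H, hinf, hsub, this⟩

end SOA

theorem theorem3p9 :
    (∀ σ : Fm, Proves RCA0 (allHorn true σ ➔ LRSAT σ)) ∧
    (∀ σ : Fm, Proves RCA0 (allHorn false σ ➔ LRSAT σ)) ∧
    (∃ θ : Fm, IsSigma01 θ ∧ ∀ σ : Fm, Proves RCA0 (allHorn true σ ➔ LRSATForced true θ σ)) ∧
    (∃ θ : Fm, IsSigma01 θ ∧ ∀ σ : Fm, Proves RCA0 (allHorn false σ ➔ LRSATForced false θ σ)) :=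
  ⟨proves_LRSAT true, proves_LRSAT false,
    ⟨(forcedByF true).ex, ⟨_, isBounded_forcedByF true, rfl⟩, proves_LRSATForced true⟩,
    ⟨(forcedByF false).ex, ⟨_, isBounded_forcedByF false, rfl⟩, proves_LRSATForced false⟩⟩
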